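/- Let $A$ be a separable unital $C^*$-algebra and let $\alpha\colon\mathbb{T}\to\mathrm{Aut}(A)$ be a continuous action of the circle group, that is, a group homomorphism such that $\zeta\mapsto\alpha_\zeta(a)$ is norm continuous for every $a\in A$. Let $A\rtimes_\alpha\mathbb{T}$ be the crossed product, that is, the enveloping $C^*$-algebra of $L^1(\mathbb{T},A)$ (equivalently, of its dense $*$-subalgebra $C(\mathbb{T},A)$ with the $L^1$-norm) for the product $(f*g)(s)=\int_{\mathbb{T}}f(t)\,\alpha_t(g(t^{-1}s))\,dt$ and the involution $f^*(s)=\alpha_s(f(s^{-1})^*)$, where $dt$ is normalized Haar measure. Let $\widehat{\alpha}\colon\mathbb{Z}\to\mathrm{Aut}(A\rtimes_\alpha\mathbb{T})$ be the dual action, determined by $\widehat{\alpha}_n(f)(\zeta)=\zeta^n f(\zeta)$ for $f\in C(\mathbb{T},A)$. The action $\alpha$ has the \emph{Rokhlin property} if for every $\varepsilon>0$ and every finite subset $F\subseteq A$ there is a unitary $u\in A$ such that $\|\alpha_\zeta(u)-\zeta u\|<\varepsilon$ for all $\zeta\in\mathbb{T}$ and $\|ua-au\|<\varepsilon$ for all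 $a\in F$. For a unital $C^*$-algebra $D$ put $D_\infty=\ell^\infty(\mathbb{N},D)/c_0(\mathbb{N},D)$, and identify $D$ with the classes of constant sequences. For an automorphism $\beta$ of a $C^*$-algebra $B$, let $M(B)^\beta$ be the algebra of those elements of the multiplier algebra $M(B)$ that are fixed by the canonical extension of $\beta$ to $M(B)$. The automorphism $\beta$ is \emph{approximately representable} if there is a unitary $v\in(M(B)^\beta)_\infty$ such that $\beta(b)=vbv^*$ in $M(B)_\infty$ for all $b\in B$. Then $\alpha$ has the Rokhlin property if and only if the automorphism $\widehat{\alpha}_1$ of $A\rtimes_\alpha\mathbb{T}$ that generates the dual action is approximately representable. -/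

import Mathlib

open MeasureTheory Filter Topology
open scoped BoundedContinuousFunction

noncomputable section

/-! ### Normalized Haar measure on the circle -/

instance Circle.instMeasurableSpace : MeasurableSpace Circle := borel Circle

instance Circle.instBorelSpace : BorelSpace Circle := ⟨rfl⟩

/-- The normalized Haar measure on the circle. -/
def circleHaar : Measure Circle := Measure.haarMeasure ⊤

instance circleHaar.instIsProbabilityMeasure : IsProbabilityMeasure circleHaar :=
  ⟨by simpa using! Measure.haarMeasure_self (K₀ := (⊤ : TopologicalSpace.PositiveCompacts Circle))⟩

instance circleHaar.instIsHaarMeasure : circleHaar.IsHaarMeasure :=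
  inferInstanceAs (Measure.haarMeasure ⊤).IsHaarMeasure

theorem integrable_circleHaar {E : Type*} [NormedAddCommGroup E] {f : Circle → E}
    (hf : Continuous f) : Integrable f circleHaar :=
  hf.integrable_of_hasCompactSupport (HasCompactSupport.of_compactSpace f)

theorem continuous_integral_circleHaar {E : Type*} [NormedAddCommGroup E] [NormedSpace ℝ E]
    {f : Circle → Circle → E} (hf : Continuous (Function.uncurry f)) :
    Continuous fun s => ∫ t, f s t ∂circleHaar := by
  simpa using! continuous_parametric_integral_of_continuous (μ := circleHaar) hf isCompact_univ

theorem integral_circleHaar_swap {E : Type*} [NormedAddCommGroup E] [NormedSpace ℝ E]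
    {f : Circle → Circle → E} (hf : Continuous (Function.uncurry f)) :
    ∫ s, ∫ t, f s t ∂circleHaar ∂circleHaar = ∫ t, ∫ s, f s t ∂circleHaar ∂circleHaar :=
  integral_integral_swap_of_hasCompactSupport hf (HasCompactSupport.of_compactSpace _)

/-! ### Circle actions and the Rokhlin property -/

/-- A (point-norm) continuous action of the circle group on a unital C⋆-algebra by
⋆-automorphisms. -/
structure CircleAction (A : Type*) [CStarAlgebra A] where
  /-- The group homomorphism from the circle to the automorphism group. -/
  toHom : Circle →* (A ≃⋆ₐ[ℂ] A)
  continuous_apply : ∀ a : A, Continuous fun ζ : Circle => toHom ζ a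

namespace CircleAction

variable {A : Type*} [CStarAlgebra A]

instance instCoeFun : CoeFun (CircleAction A) (fun _ => Circle → (A ≃⋆ₐ[ℂ] A)) :=
  ⟨fun α => α.toHom⟩

/-- The Rokhlin property for circle actions. -/
def HasRokhlinProperty (α : CircleAction A) : Prop :=
  ∀ ε : ℝ, 0 < ε → ∀ F : Finset A, ∃ u ∈ unitary A,
    (∀ ζ : Circle, ‖α ζ u - (ζ : ℂ) • u‖ < ε) ∧ ∀ a ∈ F, ‖u * a - a * u‖ < ε

theorem map_mul_apply (α : CircleAction A) (s t : Circle) (a : A) :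
    α (s * t) a = α s (α t a) := by
  simp

theorem continuous_comp (α : CircleAction A) {X : Type*} [TopologicalSpace X] {g : X → Circle}
    {f : X → A} (hg : Continuous g) (hf : Continuous f) : Continuous fun x => α (g x) (f x) := by
  rw [continuous_iff_continuousAt]
  intro x
  have h1 : Tendsto (fun y => ‖f y - f x‖) (𝓝 x) (𝓝 0) := by
    have := (hf.tendsto x).sub_const (f x)
    simpa using! this.norm
  have h2 : Tendsto (fun y => α (g y) (f y - f x)) (𝓝 x) (𝓝 0) := by
    rw [tendsto_zero_iff_norm_tendsto_zero]
    simpa only [StarAlgEquiv.norm_map] using h1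
  have h3 : Tendsto (fun y => α (g y) (f x)) (𝓝 x) (𝓝 (α (g x) (f x))) :=
    ((α.continuous_apply (f x)).comp hg).tendsto x
  have h4 := h2.add h3
  simpa [ContinuousAt, map_sub] using h4

/-- Each automorphism of the action as a continuous linear map. -/
def clm (α : CircleAction A) (t : Circle) : A →L[ℂ] A :=
  { toFun := α t
    map_add' := map_add (α t)
    map_smul' := map_smul (α t)
    cont := (StarAlgEquiv.isometry (α t)).continuous }

theorem map_integral (α : CircleAction A) (s : Circle) {f : Circle → A} (hf : Continuous f) :
    α s (∫ t, f t ∂circleHaar) = ∫ t, α s (f t) ∂circleHaar :=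
  ((α.clm s).integral_comp_comm (integrable_circleHaar hf)).symm

end CircleAction

/-! ### The twisted convolution ⋆-algebra of a circle action -/

/-- The space of continuous functions from the circle to `A`, to be equipped with the twisted
convolution product and involution coming from the action `α`. -/
def ConvolutionAlgebra {A : Type*} [CStarAlgebra A] (_α : CircleAction A) : Type _ := C(Circle, A)

namespace ConvolutionAlgebra

variable {A : Type*} [CStarAlgebra A] {α : CircleAction A}

instance instAddCommGroup : AddCommGroup (ConvolutionAlgebra α) :=
  inferInstanceAs (AddCommGroup C(Circle, A))

instance instModule : Module ℂ (ConvolutionAlgebra α) :=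
  inferInstanceAs (Module ℂ C(Circle, A))

instance instFunLike : FunLike (ConvolutionAlgebra α) Circle A :=
  inferInstanceAs (FunLike C(Circle, A) Circle A)

@[ext]
theorem ext {f g : ConvolutionAlgebra α} (h : ∀ s, f s = g s) : f = g := DFunLike.ext f g h

protected theorem continuous (f : ConvolutionAlgebra α) : Continuous f :=
  ContinuousMap.continuous (show C(Circle, A) from f)

theorem add_apply (f g : ConvolutionAlgebra α) (s : Circle) : (f + g) s = f s + g s := rfl

theorem zero_apply (s : Circle) : (0 : ConvolutionAlgebra α) s = 0 := rfl

theorem smul_apply (c : ℂ) (f : ConvolutionAlgebra α) (s : Circle) : (c • f) s = c • f s := rfl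

theorem continuous_integrand (f g : ConvolutionAlgebra α) :
    Continuous (Function.uncurry fun s t : Circle => f t * α t (g (t⁻¹ * s))) := by
  have hf := f.continuous
  have hg := g.continuous
  refine (hf.comp continuous_snd).mul (α.continuous_comp continuous_snd ?_)
  exact hg.comp (by fun_prop)

/-- The twisted convolution `(f * g)(s) = ∫ f(t) α_t(g(t⁻¹ s)) dt`. -/
instance instMul : Mul (ConvolutionAlgebra α) :=
  ⟨fun f g => (⟨fun s => ∫ t, f t * α t (g (t⁻¹ * s)) ∂circleHaar,
    continuous_integral_circleHaar (continuous_integrand f g)⟩ : C(Circle, A))⟩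

/-- The twisted involution `f⋆(s) = α_s(f(s⁻¹)⋆)`. -/
instance instStar : Star (ConvolutionAlgebra α) :=
  ⟨fun f => (⟨fun s => α s (star (f s⁻¹)),
    α.continuous_comp continuous_id (f.continuous.comp continuous_inv).star⟩ : C(Circle, A))⟩

theorem mul_apply (f g : ConvolutionAlgebra α) (s : Circle) :
    (f * g) s = ∫ t, f t * α t (g (t⁻¹ * s)) ∂circleHaar := rfl

theorem star_apply (f : ConvolutionAlgebra α) (s : Circle) : star f s = α s (star (f s⁻¹)) := rfl

theorem integrable_integrand (f g : ConvolutionAlgebra α) (s : Circle) :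
    Integrable (fun t => f t * α t (g (t⁻¹ * s))) circleHaar :=
  integrable_circleHaar ((continuous_integrand f g).comp (Continuous.prodMk_right s))

theorem continuous_section (f g : ConvolutionAlgebra α) (s : Circle) :
    Continuous (fun t => f t * α t (g (t⁻¹ * s))) :=
  (continuous_integrand f g).comp (Continuous.prodMk_right s)

protected theorem mul_assoc (f g h : ConvolutionAlgebra α) : f * g * h = f * (g * h) := by
  ext s
  have hf := f.continuous
  have hg := g.continuous
  have hh := h.continuous
  have hL : ∀ t, (∫ r, f r * α r (g (r⁻¹ * t)) ∂circleHaar) * α t (h (t⁻¹ * s))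
      = ∫ r, f r * α r (g (r⁻¹ * t)) * α t (h (t⁻¹ * s)) ∂circleHaar := fun t =>
    (((ContinuousLinearMap.mul ℂ A).flip (α t (h (t⁻¹ * s)))).integral_comp_comm
      (integrable_integrand f g t)).symm
  have hR : ∀ r, f r * α r (∫ t, g t * α t (h (t⁻¹ * (r⁻¹ * s))) ∂circleHaar)
      = ∫ t, f r * α r (g (r⁻¹ * t)) * α t (h (t⁻¹ * s)) ∂circleHaar := by
    intro r
    rw [α.map_integral r (continuous_section g h _)]
    have h1 := ((ContinuousLinearMap.mul ℂ A) (f r)).integral_comp_comm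
      (integrable_circleHaar (α.continuous_comp (continuous_const (y := r))
        (continuous_section g h (r⁻¹ * s))))
    refine h1.symm.trans ?_
    rw [← integral_mul_left_eq_self _ r⁻¹]
    refine integral_congr_ae (ae_of_all _ fun t => ?_)
    simp only [ContinuousLinearMap.mul_apply', map_mul]
    rw [mul_assoc, ← StarAlgEquiv.mul_apply, ← map_mul]
    simp [mul_assoc]
  simp only [mul_apply]
  simp_rw [hL, hR]
  refine integral_circleHaar_swap ?_
  refine Continuous.mul (Continuous.mul (hf.comp continuous_snd) ?_) ?_
  · exact α.continuous_comp continuous_snd (hg.comp (by fun_prop))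
  · exact α.continuous_comp continuous_fst (hh.comp (by fun_prop))

instance instNonUnitalRing : NonUnitalRing (ConvolutionAlgebra α) :=
  { instAddCommGroup, instMul with
    left_distrib := fun f g h => by
      ext s
      simp only [mul_apply, add_apply, map_add, mul_add]
      exact integral_add (integrable_integrand f g s) (integrable_integrand f h s)
    right_distrib := fun f g h => by
      ext s
      simp only [mul_apply, add_apply, add_mul]
      exact integral_add (integrable_integrand f h s) (integrable_integrand g h s)
    zero_mul := fun f => by ext s; simp [mul_apply, zero_apply]
    mul_zero := fun f => by ext s; simp [mul_apply, zero_apply]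
    mul_assoc := ConvolutionAlgebra.mul_assoc }

instance instIsScalarTower : IsScalarTower ℂ (ConvolutionAlgebra α) (ConvolutionAlgebra α) :=
  ⟨fun c f g => by
    ext s
    simp only [smul_eq_mul, mul_apply, smul_apply, smul_mul_assoc]
    exact integral_smul _ _⟩

instance instSMulCommClass : SMulCommClass ℂ (ConvolutionAlgebra α) (ConvolutionAlgebra α) :=
  ⟨fun c f g => by
    ext s
    simp only [smul_eq_mul, mul_apply, smul_apply, map_smul, mul_smul_comm]
    exact (integral_smul _ _).symm⟩

theorem integral_star {f : Circle → A} : star (∫ t, f t ∂circleHaar) = ∫ t, star (f t) ∂circleHaar :=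
  ((starL' ℝ : A ≃L[ℝ] A).integral_comp_comm f).symm

instance instStarRing : StarRing (ConvolutionAlgebra α) :=
  { instStar with
    star_involutive := fun f => by
      ext s
      simp only [star_apply, inv_inv, ← map_star, star_star, ← CircleAction.map_mul_apply]
      simp
    star_add := fun f g => by
      ext s
      simp [star_apply, add_apply]
    star_mul := fun f g => by
      ext s
      simp only [star_apply, mul_apply]
      rw [integral_star, α.map_integral s (continuous_section f g s⁻¹).star,
        ← integral_mul_left_eq_self _ s⁻¹]
      refine integral_congr_ae (ae_of_all _ fun t => ?_)
      have h1 : ∀ (r : Circle) (a : A), α r ((α r)⁻¹ a) = a := fun r a =>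
        StarAlgEquiv.apply_symm_apply (α r) a
      simp only [star_mul, map_mul, ← map_star, mul_inv_rev, inv_inv, map_inv,
        StarAlgEquiv.mul_apply, h1]
      rw [mul_inv_cancel_right] }

instance instStarModule : StarModule ℂ (ConvolutionAlgebra α) :=
  ⟨fun c f => by ext s; simp [star_apply, smul_apply]⟩

/-- The `L¹`-norm of a continuous function from the circle to `A`. -/
def l1Norm (f : ConvolutionAlgebra α) : ℝ := ∫ t, ‖f t‖ ∂circleHaar

/-- The C⋆-seminorms on the twisted convolution algebra that are dominated by the `L¹`-norm. Via
completion, these are exactly the seminorms `f ↦ ‖π f‖` for the `L¹`-contractive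
⋆-homomorphisms `π` from the twisted convolution algebra to C⋆-algebras. -/
structure IsBoundedCStarSeminorm (p : Seminorm ℂ (ConvolutionAlgebra α)) : Prop where
  mul_le : ∀ f g, p (f * g) ≤ p f * p g
  star_mul_self : ∀ f, p (star f * f) = p f * p f
  le_l1Norm : ∀ f, p f ≤ l1Norm f

variable (α) in
/-- The type of C⋆-seminorms dominated by the `L¹`-norm. -/
abbrev BoundedCStarSeminorm : Type _ :=
  {p : Seminorm ℂ (ConvolutionAlgebra α) // IsBoundedCStarSeminorm p}

theorem l1Norm_nonneg (f : ConvolutionAlgebra α) : 0 ≤ l1Norm f :=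
  integral_nonneg fun _ => norm_nonneg _

instance instInhabitedBoundedCStarSeminorm : Inhabited (BoundedCStarSeminorm α) :=
  ⟨0, ⟨by simp, by simp, by simpa using l1Norm_nonneg⟩⟩

theorem bddAbove_seminorm (f : ConvolutionAlgebra α) :
    BddAbove (Set.range fun p : BoundedCStarSeminorm α => p.1 f) :=
  ⟨l1Norm f, by rintro _ ⟨p, rfl⟩; exact p.2.le_l1Norm f⟩

/-- The enveloping (universal) C⋆-seminorm of the twisted convolution algebra with respect to
the `L¹`-norm: the supremum of all C⋆-seminorms dominated by the `L¹`-norm. -/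
def universalNorm (f : ConvolutionAlgebra α) : ℝ := ⨆ p : BoundedCStarSeminorm α, p.1 f

theorem le_universalNorm (p : BoundedCStarSeminorm α) (f : ConvolutionAlgebra α) :
    p.1 f ≤ universalNorm f :=
  le_ciSup (bddAbove_seminorm f) p

theorem universalNorm_nonneg (f : ConvolutionAlgebra α) : 0 ≤ universalNorm f :=
  (apply_nonneg _ f).trans (le_universalNorm default f)

theorem universalNorm_mul_le (f g : ConvolutionAlgebra α) :
    universalNorm (f * g) ≤ universalNorm f * universalNorm g :=
  ciSup_le fun p => (p.2.mul_le f g).trans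
    (mul_le_mul (le_universalNorm p f) (le_universalNorm p g) (apply_nonneg _ _)
      (universalNorm_nonneg f))

theorem universalNorm_star_mul_self (f : ConvolutionAlgebra α) :
    universalNorm f * universalNorm f ≤ universalNorm (star f * f) := by
  rw [← sq, ← Real.le_sqrt (universalNorm_nonneg f) (universalNorm_nonneg _)]
  refine ciSup_le fun p => Real.le_sqrt_of_sq_le ?_
  rw [sq, ← p.2.star_mul_self f]
  exact le_universalNorm p _

/-- The universal norm as an additive group seminorm. -/
def universalSeminorm : AddGroupSeminorm (ConvolutionAlgebra α) where
  toFun := universalNorm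
  map_zero' := by simp [universalNorm]
  add_le' f g := ciSup_le fun p => (map_add_le_add p.1 f g).trans
    (add_le_add (le_universalNorm p f) (le_universalNorm p g))
  neg' f := by simp [universalNorm]

/-- The twisted convolution algebra, with the universal C⋆-seminorm. -/
instance instNonUnitalSeminormedRing : NonUnitalSeminormedRing (ConvolutionAlgebra α) :=
  { instNonUnitalRing, universalSeminorm.toSeminormedAddCommGroup with
    norm_mul_le := universalNorm_mul_le }

theorem norm_def (f : ConvolutionAlgebra α) : ‖f‖ = universalNorm f := rfl

instance instNormedSpace : NormedSpace ℂ (ConvolutionAlgebra α) :=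
  { instModule with
    norm_smul_le := fun c f => ciSup_le fun p => by
      rw [map_smul_eq_mul]
      exact mul_le_mul_of_nonneg_left (le_universalNorm p f) (norm_nonneg c) }

theorem norm_mul_self_le (f : ConvolutionAlgebra α) : ‖f‖ * ‖f‖ ≤ ‖star f * f‖ :=
  universalNorm_star_mul_self f

theorem norm_star_le (f : ConvolutionAlgebra α) : ‖star f‖ ≤ ‖f‖ := by
  have h1 := norm_mul_self_le (star f)
  rw [star_star] at h1
  have h2 := h1.trans (norm_mul_le f (star f))
  by_cases h : ‖star f‖ = 0
  · rw [h]; exact norm_nonneg f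
  · exact le_of_mul_le_mul_right h2 (lt_of_le_of_ne (norm_nonneg _) (Ne.symm h))

end ConvolutionAlgebra

/-! ### The crossed product -/

/-- The (full) crossed product `A ⋊_α 𝕋`: the enveloping C⋆-algebra of the twisted convolution
algebra, that is, its (Hausdorff) completion in the universal C⋆-seminorm. -/
def CrossedProduct {A : Type*} [CStarAlgebra A] (α : CircleAction A) : Type _ :=
  UniformSpace.Completion (ConvolutionAlgebra α)

namespace CrossedProduct

open UniformSpace

variable {A : Type*} [CStarAlgebra A] {α : CircleAction A}

instance instNormedAddCommGroup : NormedAddCommGroup (CrossedProduct α) :=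
  inferInstanceAs (NormedAddCommGroup (Completion (ConvolutionAlgebra α)))

instance instNormedSpace : NormedSpace ℂ (CrossedProduct α) :=
  inferInstanceAs (NormedSpace ℂ (Completion (ConvolutionAlgebra α)))

instance instCompleteSpace : CompleteSpace (CrossedProduct α) :=
  inferInstanceAs (CompleteSpace (Completion (ConvolutionAlgebra α)))

/-- The canonical map from the twisted convolution algebra to the crossed product. -/
def of (f : ConvolutionAlgebra α) : CrossedProduct α := (f : Completion (ConvolutionAlgebra α))

theorem isDenseInducing_of : IsDenseInducing (of : ConvolutionAlgebra α → CrossedProduct α) :=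
  Completion.isDenseInducing_coe

theorem denseRange_of : DenseRange (of : ConvolutionAlgebra α → CrossedProduct α) :=
  Completion.denseRange_coe

theorem continuous_of : Continuous (of : ConvolutionAlgebra α → CrossedProduct α) :=
  Completion.continuous_coe _

theorem norm_of (f : ConvolutionAlgebra α) : ‖of f‖ = ‖f‖ := Completion.norm_coe f

theorem of_add (f g : ConvolutionAlgebra α) : of (f + g) = of f + of g := Completion.coe_add f g

theorem of_zero : of (0 : ConvolutionAlgebra α) = 0 := rfl

theorem of_smul (c : ℂ) (f : ConvolutionAlgebra α) : of (c • f) = c • of f :=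
  Completion.coe_smul c f

/-- `of` as an additive homomorphism. -/
def ofHom : ConvolutionAlgebra α →+ CrossedProduct α where
  toFun := of
  map_zero' := of_zero
  map_add' := of_add

/-- The multiplication of the crossed product extends that of the convolution algebra by
continuity. -/
instance instMul : Mul (CrossedProduct α) :=
  ⟨Function.curry <| (isDenseInducing_of.prodMap isDenseInducing_of).extend
    (of ∘ Function.uncurry (· * ·))⟩

/-- The involution of the crossed product extends that of the convolution algebra by
continuity. -/
instance instStar : Star (CrossedProduct α) :=
  ⟨Completion.map (star : ConvolutionAlgebra α → ConvolutionAlgebra α)⟩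

theorem of_mul (f g : ConvolutionAlgebra α) : of (f * g) = of f * of g :=
  ((isDenseInducing_of.prodMap isDenseInducing_of).extend_eq
    (continuous_of.comp continuous_mul) (f, g)).symm

theorem continuous_mul' : Continuous fun p : CrossedProduct α × CrossedProduct α => p.1 * p.2 := by
  let m := (AddMonoidHom.mul : ConvolutionAlgebra α →+ _).compr₂ ofHom
  have h : Continuous fun p : ConvolutionAlgebra α × ConvolutionAlgebra α => m p.1 p.2 :=
    continuous_of.comp continuous_mul
  have di : IsDenseInducing (ofHom : ConvolutionAlgebra α → CrossedProduct α) := isDenseInducing_of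
  exact (di.extend_Z_bilin di h :)

instance instContinuousMul : ContinuousMul (CrossedProduct α) := ⟨continuous_mul'⟩

theorem uniformContinuous_star :
    UniformContinuous (star : ConvolutionAlgebra α → ConvolutionAlgebra α) :=
  AddMonoidHomClass.uniformContinuous_of_bound (starAddEquiv : ConvolutionAlgebra α ≃+ _) 1
    fun f => by simpa using! ConvolutionAlgebra.norm_star_le f

theorem of_star (f : ConvolutionAlgebra α) : of (star f) = star (of f) :=
  (Completion.map_coe uniformContinuous_star f).symm

theorem continuous_star' : Continuous (star : CrossedProduct α → CrossedProduct α) :=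
  Completion.continuous_map

instance instContinuousStar : ContinuousStar (CrossedProduct α) := ⟨continuous_star'⟩

theorem induction_on {P : CrossedProduct α → Prop} (x : CrossedProduct α)
    (hc : IsClosed {x | P x}) (h : ∀ f, P (of f)) : P x :=
  Completion.induction_on x hc h

theorem induction_on₂ {P : CrossedProduct α → CrossedProduct α → Prop} (x y : CrossedProduct α)
    (hc : IsClosed {x : CrossedProduct α × CrossedProduct α | P x.1 x.2})
    (h : ∀ f g, P (of f) (of g)) : P x y :=
  Completion.induction_on₂ x y hc h

theorem induction_on₃ {P : CrossedProduct α → CrossedProduct α → CrossedProduct α → Prop}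
    (x y z : CrossedProduct α)
    (hc : IsClosed {x : CrossedProduct α × CrossedProduct α × CrossedProduct α |
      P x.1 x.2.1 x.2.2})
    (h : ∀ f g k, P (of f) (of g) (of k)) : P x y z :=
  Completion.induction_on₃ x y z hc h

theorem continuous_smul' (c : ℂ) : Continuous fun x : CrossedProduct α => c • x :=
  continuous_const_smul c

instance instNonUnitalRing : NonUnitalRing (CrossedProduct α) :=
  { instNormedAddCommGroup, instMul with
    zero_mul := fun x => by
      induction x using induction_on with
      | hc => exact isClosed_eq (by fun_prop) (by fun_prop)
      | h f => rw [← of_zero, ← of_mul, zero_mul]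
    mul_zero := fun x => by
      induction x using induction_on with
      | hc => exact isClosed_eq (by fun_prop) (by fun_prop)
      | h f => rw [← of_zero, ← of_mul, mul_zero]
    mul_assoc := fun x y z => by
      induction x, y, z using induction_on₃ with
      | hc => exact isClosed_eq (by fun_prop) (by fun_prop)
      | h f g k => simp only [← of_mul, mul_assoc]
    left_distrib := fun x y z => by
      induction x, y, z using induction_on₃ with
      | hc => exact isClosed_eq (by fun_prop) (by fun_prop)
      | h f g k => simp only [← of_mul, ← of_add, mul_add]
    right_distrib := fun x y z => by
      induction x, y, z using induction_on₃ with
      | hc => exact isClosed_eq (by fun_prop) (by fun_prop)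
      | h f g k => simp only [← of_mul, ← of_add, add_mul] }

instance instNonUnitalNormedRing : NonUnitalNormedRing (CrossedProduct α) :=
  { instNormedAddCommGroup, instNonUnitalRing with
    norm_mul_le := fun x y => by
      induction x, y using induction_on₂ with
      | hc => exact isClosed_le (by fun_prop) (by fun_prop)
      | h f g => simpa only [← of_mul, norm_of] using norm_mul_le f g }

instance instStarRing : StarRing (CrossedProduct α) :=
  { instStar with
    star_involutive := fun x => by
      induction x using induction_on with
      | hc => exact isClosed_eq (by fun_prop) (by fun_prop)
      | h f => simp only [← of_star, star_star]
    star_add := fun x y => by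
      induction x, y using induction_on₂ with
      | hc => exact isClosed_eq (by fun_prop) (by fun_prop)
      | h f g => simp only [← of_star, ← of_add, star_add]
    star_mul := fun x y => by
      induction x, y using induction_on₂ with
      | hc => exact isClosed_eq (by fun_prop) (by fun_prop)
      | h f g => simp only [← of_star, ← of_mul, star_mul] }

instance instIsScalarTower : IsScalarTower ℂ (CrossedProduct α) (CrossedProduct α) :=
  ⟨fun c x y => by
    simp only [smul_eq_mul]
    induction x, y using induction_on₂ with
    | hc => exact isClosed_eq (((continuous_smul' c).comp continuous_fst).mul continuous_snd)
              ((continuous_smul' c).comp continuous_mul')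
    | h f g => simp only [← of_mul, ← of_smul, smul_mul_assoc]⟩

instance instSMulCommClass : SMulCommClass ℂ (CrossedProduct α) (CrossedProduct α) :=
  ⟨fun c x y => by
    simp only [smul_eq_mul]
    induction x, y using induction_on₂ with
    | hc => exact isClosed_eq ((continuous_smul' c).comp continuous_mul')
              (continuous_fst.mul ((continuous_smul' c).comp continuous_snd))
    | h f g => simp only [← of_mul, ← of_smul, mul_smul_comm]⟩

instance instStarModule : StarModule ℂ (CrossedProduct α) :=
  ⟨fun c x => by
    induction x using induction_on with
    | hc => exact isClosed_eq (continuous_star'.comp (continuous_smul' c))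
              ((continuous_smul' (star c)).comp continuous_star')
    | h f => simp only [← of_star, ← of_smul, star_smul]⟩

instance instCStarRing : CStarRing (CrossedProduct α) :=
  ⟨fun x => by
    induction x using induction_on with
    | hc => exact isClosed_le (by fun_prop) (by fun_prop)
    | h f => simpa only [← of_star, ← of_mul, norm_of] using ConvolutionAlgebra.norm_mul_self_le f⟩

/-- The crossed product is a (generally non-unital) C⋆-algebra. -/
instance instNonUnitalCStarAlgebra : NonUnitalCStarAlgebra (CrossedProduct α) where

end CrossedProduct

/-! ### The dual action -/

namespace ConvolutionAlgebra

variable {A : Type*} [CStarAlgebra A] {α : CircleAction A}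

/-- Pointwise multiplication by the character `ζ ↦ ζ ^ n` of the circle. -/
def modulate (n : ℤ) (f : ConvolutionAlgebra α) : ConvolutionAlgebra α :=
  (⟨fun s => ((s ^ n : Circle) : ℂ) • f s,
    ((show Continuous fun z : Circle => (z : ℂ) by fun_prop).comp (continuous_zpow n)).smul
      f.continuous⟩ : C(Circle, A))

theorem modulate_apply (n : ℤ) (f : ConvolutionAlgebra α) (s : Circle) :
    modulate n f s = ((s ^ n : Circle) : ℂ) • f s := rfl

theorem modulate_add (n : ℤ) (f g : ConvolutionAlgebra α) :
    modulate n (f + g) = modulate n f + modulate n g := by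
  ext s; simp [modulate_apply, add_apply]

theorem modulate_smul (n : ℤ) (c : ℂ) (f : ConvolutionAlgebra α) :
    modulate n (c • f) = c • modulate n f := by
  ext s; simp only [modulate_apply, smul_apply]; rw [smul_comm]

theorem modulate_mul (n : ℤ) (f g : ConvolutionAlgebra α) :
    modulate n (f * g) = modulate n f * modulate n g := by
  ext s
  simp only [modulate_apply, mul_apply]
  rw [← integral_smul]
  refine integral_congr_ae (ae_of_all _ fun t => ?_)
  simp only [map_smul, smul_mul_smul_comm, ← Circle.coe_mul, ← mul_zpow, mul_inv_cancel_left]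

theorem modulate_star (n : ℤ) (f : ConvolutionAlgebra α) :
    modulate n (star f) = star (modulate n f) := by
  ext s
  simp [modulate_apply, star_apply, ← Circle.coe_inv_eq_conj]

theorem modulate_zero_left (f : ConvolutionAlgebra α) : modulate 0 f = f := by
  ext s; simp [modulate_apply]

theorem modulate_modulate (m n : ℤ) (f : ConvolutionAlgebra α) :
    modulate m (modulate n f) = modulate (m + n) f := by
  ext s; simp only [modulate_apply, zpow_add, Circle.coe_mul, mul_smul]

theorem l1Norm_modulate (n : ℤ) (f : ConvolutionAlgebra α) : l1Norm (modulate n f) = l1Norm f := by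
  simp only [l1Norm, modulate_apply, norm_smul, Circle.norm_coe, one_mul]

/-- `modulate n` as a linear map. -/
def modulateₗ (n : ℤ) : ConvolutionAlgebra α →ₗ[ℂ] ConvolutionAlgebra α where
  toFun := modulate n
  map_add' := modulate_add n
  map_smul' := modulate_smul n

theorem norm_modulate_le (n : ℤ) (f : ConvolutionAlgebra α) : ‖modulate n f‖ ≤ ‖f‖ :=
  ciSup_le fun p => le_universalNorm (f := f) ⟨p.1.comp (modulateₗ n),
    { mul_le := fun f g => by
        simpa only [Seminorm.comp_apply, modulateₗ, LinearMap.coe_mk, AddHom.coe_mk, modulate_mul]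
          using p.2.mul_le _ _
      star_mul_self := fun f => by
        simpa only [Seminorm.comp_apply, modulateₗ, LinearMap.coe_mk, AddHom.coe_mk, modulate_mul,
          modulate_star] using p.2.star_mul_self _
      le_l1Norm := fun f => by
        simpa only [Seminorm.comp_apply, modulateₗ, LinearMap.coe_mk, AddHom.coe_mk,
          l1Norm_modulate] using p.2.le_l1Norm (modulate n f) }⟩

theorem uniformContinuous_modulate (n : ℤ) :
    UniformContinuous (modulate n : ConvolutionAlgebra α → ConvolutionAlgebra α) :=
  AddMonoidHomClass.uniformContinuous_of_bound (modulateₗ n : ConvolutionAlgebra α →ₗ[ℂ] _) 1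
    fun f => by simpa using! norm_modulate_le n f

end ConvolutionAlgebra

namespace CrossedProduct

open UniformSpace

variable {A : Type*} [CStarAlgebra A] {α : CircleAction A}

/-- The extension of `ConvolutionAlgebra.modulate n` to the crossed product by continuity. -/
def dualMap (n : ℤ) : CrossedProduct α → CrossedProduct α :=
  Completion.map (ConvolutionAlgebra.modulate n : ConvolutionAlgebra α → ConvolutionAlgebra α)

theorem dualMap_of (n : ℤ) (f : ConvolutionAlgebra α) :
    dualMap n (of f) = of (ConvolutionAlgebra.modulate n f) :=
  Completion.map_coe (ConvolutionAlgebra.uniformContinuous_modulate n) f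

theorem continuous_dualMap (n : ℤ) :
    Continuous (dualMap n : CrossedProduct α → CrossedProduct α) :=
  Completion.continuous_map

theorem dualMap_zero_left (x : CrossedProduct α) : dualMap 0 x = x := by
  induction x using induction_on with
  | hc => exact isClosed_eq (continuous_dualMap 0) continuous_id
  | h f => rw [dualMap_of, ConvolutionAlgebra.modulate_zero_left]

theorem dualMap_dualMap (m n : ℤ) (x : CrossedProduct α) :
    dualMap m (dualMap n x) = dualMap (m + n) x := by
  induction x using induction_on with
  | hc => exact isClosed_eq ((continuous_dualMap m).comp (continuous_dualMap n))
            (continuous_dualMap (m + n))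
  | h f => rw [dualMap_of, dualMap_of, dualMap_of, ConvolutionAlgebra.modulate_modulate]

/-- The automorphism of the crossed product determined by `f(ζ) ↦ ζ ^ n f(ζ)` on continuous
functions. -/
def dualAut (n : ℤ) : CrossedProduct α ≃⋆ₐ[ℂ] CrossedProduct α where
  toFun := dualMap n
  invFun := dualMap (-n)
  left_inv x := by rw [dualMap_dualMap, neg_add_cancel, dualMap_zero_left]
  right_inv x := by rw [dualMap_dualMap, add_neg_cancel, dualMap_zero_left]
  map_mul' x y := by
    induction x, y using induction_on₂ with
    | hc => exact isClosed_eq ((continuous_dualMap n).comp continuous_mul')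
              (((continuous_dualMap n).comp continuous_fst).mul
                ((continuous_dualMap n).comp continuous_snd))
    | h f g => simp only [← of_mul, dualMap_of, ConvolutionAlgebra.modulate_mul]
  map_add' x y := by
    induction x, y using induction_on₂ with
    | hc => exact isClosed_eq ((continuous_dualMap n).comp continuous_add)
              (((continuous_dualMap n).comp continuous_fst).add
                ((continuous_dualMap n).comp continuous_snd))
    | h f g => simp only [← of_add, dualMap_of, ConvolutionAlgebra.modulate_add]
  map_star' x := by
    induction x using induction_on with
    | hc => exact isClosed_eq ((continuous_dualMap n).comp continuous_star')
              (continuous_star'.comp (continuous_dualMap n))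
    | h f => simp only [← of_star, dualMap_of, ConvolutionAlgebra.modulate_star]
  map_smul' c x := by
    induction x using induction_on with
    | hc => exact isClosed_eq ((continuous_dualMap n).comp (continuous_smul' c))
              ((continuous_smul' c).comp (continuous_dualMap n))
    | h f => simp only [← of_smul, dualMap_of, ConvolutionAlgebra.modulate_smul]

end CrossedProduct

/-- The dual action of `ℤ` (the Pontryagin dual of the circle) on the crossed product. -/
def CircleAction.dualAction {A : Type*} [CStarAlgebra A] (α : CircleAction A) :
    Multiplicative ℤ →* (CrossedProduct α ≃⋆ₐ[ℂ] CrossedProduct α) where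
  toFun n := CrossedProduct.dualAut (Multiplicative.toAdd n)
  map_one' := by ext x; exact CrossedProduct.dualMap_zero_left x
  map_mul' m n := by ext x; exact (CrossedProduct.dualMap_dualMap _ _ x).symm

/-! ### Sequence algebras -/

section SequenceAlgebra

variable (D : Type*) [CStarAlgebra D]

/-- The two-sided ideal `c₀(ℕ, D)` of `ℓ^∞(ℕ, D)` (bounded functions on the discrete space `ℕ`). -/
def c0Ideal : Ideal (ℕ →ᵇ D) where
  carrier := {x | Tendsto (fun n => ‖x n‖) atTop (𝓝 0)}
  zero_mem' := by simp
  add_mem' {x y} hx hy := squeeze_zero (fun n => norm_nonneg _) (fun n => norm_add_le (x n) (y n))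
    (by simpa using hx.add hy)
  smul_mem' x y hy := squeeze_zero (fun n => norm_nonneg _)
    (fun n => (norm_mul_le (x n) (y n)).trans
      (mul_le_mul_of_nonneg_right (x.norm_coe_le_norm n) (norm_nonneg _)))
    (by simpa using hy.const_mul ‖x‖)

instance c0Ideal.instIsTwoSided : (c0Ideal D).IsTwoSided :=
  ⟨fun {x} y hx => squeeze_zero (fun n => norm_nonneg _)
    (fun n => (norm_mul_le (x n) (y n)).trans
      (mul_le_mul_of_nonneg_left (y.norm_coe_le_norm n) (norm_nonneg _)))
    (by simpa using Tendsto.mul_const ‖y‖ hx)⟩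

/-- The sequence algebra `D_∞ = ℓ^∞(ℕ, D) / c₀(ℕ, D)`. -/
abbrev SequenceAlgebra : Type _ := (ℕ →ᵇ D) ⧸ c0Ideal D

variable {D}

theorem star_mem_c0Ideal {x : ℕ →ᵇ D} (hx : x ∈ c0Ideal D) : star x ∈ c0Ideal D := by
  have h : Tendsto (fun n => ‖x n‖) atTop (𝓝 0) := hx
  change Tendsto (fun n => ‖star (x n)‖) atTop (𝓝 0)
  simpa only [norm_star] using h

instance SequenceAlgebra.instStar : Star (SequenceAlgebra D) :=
  ⟨QuotientAddGroup.map _ _ (starAddEquiv : (ℕ →ᵇ D) ≃+ (ℕ →ᵇ D)).toAddMonoidHom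
    fun _ hx => star_mem_c0Ideal hx⟩

theorem SequenceAlgebra.star_mk (x : ℕ →ᵇ D) :
    star (Ideal.Quotient.mk (c0Ideal D) x) = Ideal.Quotient.mk (c0Ideal D) (star x) := rfl

instance SequenceAlgebra.instStarRing : StarRing (SequenceAlgebra D) :=
  { SequenceAlgebra.instStar with
    star_involutive := fun x => by
      obtain ⟨x, rfl⟩ := Ideal.Quotient.mk_surjective x
      simp only [SequenceAlgebra.star_mk, star_star]
    star_mul := fun x y => by
      obtain ⟨x, rfl⟩ := Ideal.Quotient.mk_surjective x
      obtain ⟨y, rfl⟩ := Ideal.Quotient.mk_surjective y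
      simp only [SequenceAlgebra.star_mk, ← map_mul, star_mul]
    star_add := fun x y => by
      obtain ⟨x, rfl⟩ := Ideal.Quotient.mk_surjective x
      obtain ⟨y, rfl⟩ := Ideal.Quotient.mk_surjective y
      simp only [SequenceAlgebra.star_mk, ← map_add, star_add] }

/-- The class in `D_∞` of the constant sequence with value `d`. -/
def SequenceAlgebra.const (d : D) : SequenceAlgebra D :=
  Ideal.Quotient.mk (c0Ideal D) (BoundedContinuousFunction.const ℕ d)

variable {E : Type*} [CStarAlgebra E]

/-- The entrywise application of a unital ⋆-homomorphism to bounded sequences. -/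
def seqMap (φ : D →⋆ₐ[ℂ] E) : (ℕ →ᵇ D) →+* (ℕ →ᵇ E) where
  toFun x := BoundedContinuousFunction.ofNormedAddCommGroup (fun n => φ (x n))
    continuous_of_discreteTopology ‖x‖
    fun n => (NonUnitalStarAlgHom.norm_apply_le φ _).trans (x.norm_coe_le_norm n)
  map_one' := by ext n; simp
  map_mul' x y := by ext n; simp
  map_zero' := by ext n; simp
  map_add' x y := by ext n; simp

/-- The homomorphism `D_∞ → E_∞` induced by a unital ⋆-homomorphism `D → E`. -/
def SequenceAlgebra.map (φ : D →⋆ₐ[ℂ] E) : SequenceAlgebra D →+* SequenceAlgebra E :=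
  Ideal.quotientMap (c0Ideal E) (seqMap φ) fun x hx =>
    squeeze_zero (fun _ => norm_nonneg _) (fun n => NonUnitalStarAlgHom.norm_apply_le φ (x n)) hx

end SequenceAlgebra

/-! ### Approximately representable automorphisms -/

section ApproximatelyRepresentable

open scoped MultiplierAlgebra

variable {B : Type*} [NonUnitalCStarAlgebra B]

/-- A ⋆-automorphism of a C⋆-algebra as a continuous linear map. -/
def starAlgEquivCLM (β : B ≃⋆ₐ[ℂ] B) : B →L[ℂ] B :=
  { toFun := β
    map_add' := map_add β
    map_smul' := map_smul β
    cont := (StarAlgEquiv.isometry β).continuous }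

/-- The canonical extension of a ⋆-automorphism `β` to multipliers,
`(L, R) ↦ (β ∘ L ∘ β⁻¹, β ∘ R ∘ β⁻¹)`. -/
def multiplierConj (β : B ≃⋆ₐ[ℂ] B) (x : 𝓜(ℂ, B)) : 𝓜(ℂ, B) where
  fst := (starAlgEquivCLM β).comp (x.fst.comp (starAlgEquivCLM β.symm))
  snd := (starAlgEquivCLM β).comp (x.snd.comp (starAlgEquivCLM β.symm))
  central a b := by
    have h := congrArg β (x.central (β.symm a) (β.symm b))
    simpa [starAlgEquivCLM] using! h

theorem multiplier_ext {x y : 𝓜(ℂ, B)} (h₁ : ∀ b, x.fst b = y.fst b)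
    (h₂ : ∀ b, x.snd b = y.snd b) : x = y :=
  DoubleCentralizer.ext ℂ B x y
    (Prod.ext (ContinuousLinearMap.ext h₁) (ContinuousLinearMap.ext h₂))

theorem multiplierConj_fst (β : B ≃⋆ₐ[ℂ] B) (x : 𝓜(ℂ, B)) (b : B) :
    (multiplierConj β x).fst b = β (x.fst (β.symm b)) := rfl

theorem multiplierConj_snd (β : B ≃⋆ₐ[ℂ] B) (x : 𝓜(ℂ, B)) (b : B) :
    (multiplierConj β x).snd b = β (x.snd (β.symm b)) := rfl

/-- The canonical extension of a ⋆-automorphism to the multiplier algebra, as a unital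
⋆-homomorphism. -/
def multiplierMap (β : B ≃⋆ₐ[ℂ] B) : 𝓜(ℂ, B) →⋆ₐ[ℂ] 𝓜(ℂ, B) where
  toFun := multiplierConj β
  map_one' := multiplier_ext (fun b => β.apply_symm_apply b) (fun b => β.apply_symm_apply b)
  map_mul' x y := multiplier_ext
    (fun b => by
      simp [multiplierConj_fst])
    (fun b => by
      simp [multiplierConj_snd])
  map_zero' := multiplier_ext (fun b => map_zero β) (fun b => map_zero β)
  map_add' x y := multiplier_ext (fun b => map_add β _ _) (fun b => map_add β _ _)
  commutes' c := multiplier_ext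
    (fun b => by
      simp [multiplierConj_fst, Algebra.algebraMap_eq_smul_one])
    (fun b => by
      simp [multiplierConj_snd, Algebra.algebraMap_eq_smul_one])
  map_star' x := multiplier_ext
    (fun b => by
      simp [multiplierConj_fst, multiplierConj_snd, map_star])
    (fun b => by
      simp [multiplierConj_fst, multiplierConj_snd, map_star])

/-- The algebra `M(B)^β` of multipliers of `B` that are fixed by the extension of `β`. -/
def fixedMultipliers (β : B ≃⋆ₐ[ℂ] B) : StarSubalgebra ℂ 𝓜(ℂ, B) :=
  StarAlgHom.equalizer (multiplierMap β) (StarAlgHom.id ℂ 𝓜(ℂ, B))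

theorem isClosed_fixedMultipliers (β : B ≃⋆ₐ[ℂ] B) :
    IsClosed (fixedMultipliers β : Set 𝓜(ℂ, B)) :=
  isClosed_eq
    (AddMonoidHomClass.continuous_of_bound (multiplierMap β) 1
      fun x => by simpa using NonUnitalStarAlgHom.norm_apply_le (multiplierMap β) x)
    continuous_id

instance fixedMultipliers.instCStarAlgebra (β : B ≃⋆ₐ[ℂ] B) : CStarAlgebra (fixedMultipliers β) :=
  StarSubalgebra.cstarAlgebra _ (h_closed := isClosed_fixedMultipliers β)

/-- An automorphism `β` of a C⋆-algebra `B` is approximately representable if there is a unitary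
`v ∈ (M(B)^β)_∞` with `β(b) = v b v⋆` in `M(B)_∞` for all `b ∈ B`. -/
def IsApproximatelyRepresentable (β : B ≃⋆ₐ[ℂ] B) : Prop :=
  ∃ v ∈ unitary (SequenceAlgebra (fixedMultipliers β)), ∀ b : B,
    SequenceAlgebra.const (DoubleCentralizer.coe ℂ (β b)) =
      SequenceAlgebra.map (fixedMultipliers β).subtype v *
        SequenceAlgebra.const (DoubleCentralizer.coe ℂ b) *
          star (SequenceAlgebra.map (fixedMultipliers β).subtype v)

end ApproximatelyRepresentable

end

/-!
# Rokhlin actions of the circle and approximately representable dual actions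

Let `B` be the crossed product of `A` by the circle action `α`. The algebra `A` embeds into `M(B)` by
`(a f)(s) = a f(s)` and `(f a)(s) = f(s) α_s(a)`, and its image is fixed by the dual action
(`CrossedProduct.embed`, `CrossedProduct.multiplierMap_dualAut_embed`).

If `α` has the Rokhlin property, separability gives an asymptotically central sequence of unitaries
`u n` with `α_s(u n) ≈ s (u n)` uniformly in `s`. For `f ∈ C(𝕋, A)` the value of `(u n)⋆ f (u n)` at
`s` is `(u n)⋆ f(s) α_s(u n) ≈ s f(s)`, so conjugation by the class of `(u n)⋆` implements the dual
automorphism, first in the `L¹`-norm and then, by density, on all of `B`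
(`CrossedProduct.tendsto_norm_dualMap_sub_conj`).

Conversely, fixed multipliers need not lie in `A` (for translation on `C(𝕋)` they form `L^∞(𝕋)`), so
a unitary `v` representing the dual automorphism has to be replaced by its homogeneous component of
degree `-1`. The functions `p_m(ζ) = ζ ^ m` are projections in `B`, shifted by the dual automorphism,
and `a p_m = p_{m-k} a` whenever `a` is homogeneous of degree `k`. The corner `p₁ B p₀` consists of
the elements `a p₀` with `a` of degree `-1` (`CrossedProduct.exists_proj_one_mul_mul_proj_zero`), so a
fixed multiplier `x` determines such an `a` with `p_{k+1} x p_k = a p_k` for all `k`. As `v` maps `p_k`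
to `p_{k+1}`, the sequence `u n` of these components satisfies `v p_k = u p_k` in `M(B)_∞`, and this
makes `u` unitary and central relative to homogeneous elements, up to multiplication by some `p_m`
(`shift_relations`). Such a factor is harmless because `‖a p_m‖ = ‖a‖` for homogeneous `a`
(`ConvolutionAlgebra.norm_monomial`); this is where the crossed product is shown to be large, by means
of its regular representation on `L²(𝕋, A)`. Homogeneous elements span a dense subspace
(`CircleAction.iSup_spectralSubspace_topologicalClosure`), and the adjoint of the unitary part of `u n`
is a Rokhlin unitary.
-/

noncomputable section

/-! ### The regular representation on the Hilbert module `L²(𝕋, A)` -/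

/-- The twisted convolution algebra as a left pre-Hilbert module over `A`, with the `A`-valued
inner product `⟪x, y⟫ = (y * x⋆)(1) = ∫ y(t) x(t)⋆ dt`; its completion is `L²(𝕋, A)`. It is a
separate type because its norm differs from the universal norm. -/
def RegularModule {A : Type*} [CStarAlgebra A] (α : CircleAction A) : Type _ :=
  ConvolutionAlgebra α

namespace RegularModule

open ConvolutionAlgebra

variable {A : Type*} [CStarAlgebra A] {α : CircleAction A}

instance instAddCommGroup : AddCommGroup (RegularModule α) :=
  inferInstanceAs (AddCommGroup (ConvolutionAlgebra α))

instance instModule : Module ℂ (RegularModule α) :=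
  inferInstanceAs (Module ℂ (ConvolutionAlgebra α))

instance instFunLike : FunLike (RegularModule α) Circle A :=
  inferInstanceAs (FunLike (ConvolutionAlgebra α) Circle A)

/-- An element of the twisted convolution algebra, as an element of the regular module. -/
def of (f : ConvolutionAlgebra α) : RegularModule α := f

protected theorem continuous (x : RegularModule α) : Continuous x :=
  ConvolutionAlgebra.continuous (α := α) x

instance instSMul : SMul A (RegularModule α) :=
  ⟨fun a x => (⟨fun s => a * x s, continuous_const.mul x.continuous⟩ : C(Circle, A))⟩

instance instInner : Inner A (RegularModule α) :=
  ⟨fun x y => ((show ConvolutionAlgebra α from y) * star (show ConvolutionAlgebra α from x)) 1⟩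

instance instNorm : Norm (RegularModule α) := CStarModule.norm A

theorem inner_eq_integral (x y : RegularModule α) :
    inner A x y = ∫ t, y t * star (x t) ∂circleHaar := by
  change ((show ConvolutionAlgebra α from y) * star (show ConvolutionAlgebra α from x)) 1 = _
  rw [mul_apply]
  refine integral_congr_ae (ae_of_all _ fun t => congrArg (y t * ·) ?_)
  change α t (α (t⁻¹ * 1) (star (x (t⁻¹ * 1)⁻¹))) = star (x t)
  rw [← α.map_mul_apply]
  simp

/-- Right convolution by `f` on the regular module. -/
def mulRight (f : ConvolutionAlgebra α) : RegularModule α →ₗ[ℂ] RegularModule α :=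
  LinearMap.mulRight ℂ f

theorem inner_mulRight (f : ConvolutionAlgebra α) (x y : RegularModule α) :
    inner A x (mulRight f y) = inner A (mulRight (star f) x) y := by
  have : (show ConvolutionAlgebra α from y) * f * star (show ConvolutionAlgebra α from x)
      = (show ConvolutionAlgebra α from y) * star ((show ConvolutionAlgebra α from x) * star f) := by
    rw [star_mul, star_star, mul_assoc]
  exact congrArg (fun f : ConvolutionAlgebra α => f 1) this

/-- The vector `x_r` in the decomposition `x * f = ∫ x_r dr` of the right convolution by `f`. Its
norm is at most `‖f r‖ ‖x‖`, which bounds right convolution by the `L¹`-norm of `f`. -/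
def rightTranslate (f : ConvolutionAlgebra α) (x : RegularModule α) (r : Circle) :
    RegularModule α :=
  (⟨fun s => x (s * r⁻¹) * α (s * r⁻¹) (f r), (x.continuous.comp (by fun_prop)).mul
    (α.continuous_comp (by fun_prop) continuous_const)⟩ : C(Circle, A))

theorem mulRight_eq_integral (f : ConvolutionAlgebra α) (x : RegularModule α) (s : Circle) :
    mulRight f x s = ∫ r, rightTranslate f x r s ∂circleHaar := by
  change ∫ t, x t * α t (f (t⁻¹ * s)) ∂circleHaar = _
  rw [← integral_inv_eq_self (fun t => x t * α t (f (t⁻¹ * s))), ← integral_mul_left_eq_self _ s⁻¹]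
  refine integral_congr_ae (ae_of_all _ fun r => ?_)
  change _ = x (s * r⁻¹) * α (s * r⁻¹) (f r)
  simp only [mul_inv_rev, inv_inv]
  rw [mul_comm r⁻¹ s, mul_comm s⁻¹ r, mul_assoc, inv_mul_cancel, mul_one]

variable [PartialOrder A] [StarOrderedRing A]

/-- The integral of a continuous nonnegative function is faithful. -/
theorem _root_.eq_zero_of_integral_circleHaar_eq_zero {f : Circle → A} (hf : Continuous f)
    (h0 : 0 ≤ f) (h : ∫ t, f t ∂circleHaar = 0) : f = 0 := by
  have hi := integrable_circleHaar hf
  rw [← Continuous.ae_eq_iff_eq circleHaar hf continuous_zero]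
  refine hi.ae_eq_zero_of_forall_setIntegral_eq_zero fun s _ _ => le_antisymm ?_ ?_
  · have := setIntegral_mono_set (s := s) (t := Set.univ) (μ := circleHaar) hi.integrableOn
      (ae_of_all _ h0) (ae_of_all _ (Set.subset_univ s))
    simpa [h] using this
  · exact integral_nonneg h0

instance instCStarModule : CStarModule A (RegularModule α) where
  inner_add_right {x y z} := by
    change ((show ConvolutionAlgebra α from y + z) * star (show ConvolutionAlgebra α from x)) 1 = _
    exact congrArg (fun f : ConvolutionAlgebra α => f 1)
      (add_mul (show ConvolutionAlgebra α from y) z (star (show ConvolutionAlgebra α from x)))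
  inner_self_nonneg {x} := by
    rw [inner_eq_integral]
    exact integral_nonneg fun t => mul_star_self_nonneg _
  inner_self {x} := by
    rw [inner_eq_integral]
    refine ⟨fun h => ?_, fun h => by subst h; exact (integral_congr_ae
      (ae_of_all _ fun t => zero_mul _)).trans (integral_zero _ _)⟩
    have := eq_zero_of_integral_circleHaar_eq_zero (x.continuous.mul x.continuous.star)
      (fun t => mul_star_self_nonneg _) h
    refine DFunLike.ext _ _ fun t => ?_
    exact CStarRing.mul_star_self_eq_zero_iff _ |>.1 (congrFun this t)
  inner_op_smul_right {a x y} := by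
    rw [inner_eq_integral, inner_eq_integral]
    refine Eq.trans ?_ (((ContinuousLinearMap.mul ℂ A) a).integral_comp_comm
      (integrable_circleHaar (y.continuous.mul x.continuous.star)))
    exact integral_congr_ae (ae_of_all _ fun t => mul_assoc a (y t) (star (x t)))
  inner_smul_right_complex {z x y} :=
    congrArg (fun f : ConvolutionAlgebra α => f 1)
      (smul_mul_assoc z (show ConvolutionAlgebra α from y)
        (star (show ConvolutionAlgebra α from x)))
  star_inner x y := by
    rw [inner_eq_integral, inner_eq_integral, integral_star]
    simp
  norm_eq_sqrt_norm_inner_self x := rfl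

instance instNormedAddCommGroup : NormedAddCommGroup (RegularModule α) :=
  NormedAddCommGroup.ofCore (CStarModule.normedSpaceCore A)

instance instNormedSpace : NormedSpace ℂ (RegularModule α) :=
  NormedSpace.ofCore (CStarModule.normedSpaceCore A)

theorem norm_rightTranslate_le (f : ConvolutionAlgebra α) (x : RegularModule α) (r : Circle) :
    ‖rightTranslate f x r‖ ≤ ‖f r‖ * ‖x‖ := by
  have key : (inner A (rightTranslate f x r) (rightTranslate f x r) : A)
      ≤ (‖f r‖ ^ 2) • inner A x x := by
    rw [inner_eq_integral, inner_eq_integral, ← integral_smul]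
    have : ∀ s, rightTranslate f x r s * star (rightTranslate f x r s)
        = (fun s => x s * (α s (f r * star (f r))) * star (x s)) (s * r⁻¹) := fun s => by
      change (x (s * r⁻¹) * α (s * r⁻¹) (f r)) * star (x (s * r⁻¹) * α (s * r⁻¹) (f r)) = _
      simp only [star_mul, mul_assoc, map_mul, map_star]
    rw [integral_congr_ae (ae_of_all _ this),
      integral_mul_right_eq_self (fun s => x s * (α s (f r * star (f r))) * star (x s))]
    have hx := x.continuous
    refine integral_mono (integrable_circleHaar ?_) (integrable_circleHaar ?_) fun s => ?_
    · exact (hx.mul (α.continuous_comp continuous_id continuous_const)).mul hx.star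
    · exact (hx.mul hx.star).const_smul _
    · have h := CStarAlgebra.star_right_conjugate_le_norm_smul (a := x s)
        (b := α s (f r * star (f r))) (by
          rw [IsSelfAdjoint, ← map_star]; simp)
      rwa [StarAlgEquiv.norm_map, CStarRing.norm_self_mul_star, ← sq] at h
  have h0 : (0 : A) ≤ inner A (rightTranslate f x r) (rightTranslate f x r) :=
    CStarModule.inner_self_nonneg (A := A) (E := RegularModule α)
  have h1 := CStarAlgebra.norm_le_norm_of_nonneg_of_le h0 key
  rw [norm_smul, ← CStarModule.norm_sq_eq, ← CStarModule.norm_sq_eq, norm_pow, norm_norm,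
    ← mul_pow] at h1
  exact (sq_le_sq₀ (norm_nonneg _) (by positivity)).1 h1

theorem norm_mulRight_le (f : ConvolutionAlgebra α) (x : RegularModule α) :
    ‖mulRight f x‖ ≤ l1Norm f * ‖x‖ := by
  set y := mulRight f x
  have hf := f.continuous
  have hx := x.continuous
  have hyc := y.continuous
  have hc : Continuous (Function.uncurry fun s r : Circle =>
      rightTranslate f x r s * star (y s)) := by
    change Continuous fun p : Circle × Circle =>
      x (p.1 * p.2⁻¹) * α (p.1 * p.2⁻¹) (f p.2) * star (y p.1)
    refine ((hx.comp (by fun_prop)).mul (α.continuous_comp (by fun_prop) ?_)).mul ?_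
    · exact hf.comp continuous_snd
    · exact (hyc.comp continuous_fst).star
  have h1 : (inner A y y : A) = ∫ r, inner A y (rightTranslate f x r) ∂circleHaar := by
    simp only [inner_eq_integral]
    rw [← integral_circleHaar_swap hc]
    refine integral_congr_ae (ae_of_all _ fun s => ?_)
    have h2 := ((ContinuousLinearMap.mul ℂ A).flip (star (y s))).integral_comp_comm
      (φ := fun r => rightTranslate f x r s) (μ := circleHaar) (integrable_circleHaar (by
        change Continuous fun r => x (s * r⁻¹) * α (s * r⁻¹) (f r)
        exact (hx.comp (by fun_prop)).mul (α.continuous_comp (by fun_prop) hf)))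
    simp only [ContinuousLinearMap.flip_apply, ContinuousLinearMap.mul_apply'] at h2
    exact (congrArg (· * star (y s)) (mulRight_eq_integral f x s)).trans h2.symm
  have h2 : ‖y‖ ^ 2 ≤ ‖y‖ * (l1Norm f * ‖x‖) := by
    rw [CStarModule.norm_sq_eq (A := A), h1]
    calc ‖∫ r, (inner A y (rightTranslate f x r) : A) ∂circleHaar‖
        ≤ ∫ r, ‖f r‖ * (‖y‖ * ‖x‖) ∂circleHaar := by
          refine norm_integral_le_of_norm_le ((integrable_circleHaar hf.norm).mul_const _)
            (ae_of_all _ fun r => ?_)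
          calc _ ≤ ‖y‖ * ‖rightTranslate f x r‖ := CStarModule.norm_inner_le _
            _ ≤ ‖y‖ * (‖f r‖ * ‖x‖) := by gcongr; exact norm_rightTranslate_le f x r
            _ = _ := by ring
      _ = ‖y‖ * (l1Norm f * ‖x‖) := by rw [integral_mul_const, l1Norm]; ring
  rcases (norm_nonneg y).eq_or_lt with h | h
  · rw [← h]; exact mul_nonneg (l1Norm_nonneg f) (norm_nonneg x)
  · rw [sq] at h2; exact le_of_mul_le_mul_left h2 h

/-- The right regular representation: right convolution by `f` as a bounded operator. -/
def rightRegular : ConvolutionAlgebra α →ₗ[ℂ] (RegularModule α →L[ℂ] RegularModule α) where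
  toFun f := (mulRight f).mkContinuous (l1Norm f) (norm_mulRight_le f)
  map_add' f g := ContinuousLinearMap.ext fun x =>
    mul_add (show ConvolutionAlgebra α from x) f g
  map_smul' c f := ContinuousLinearMap.ext fun x =>
    mul_smul_comm c (show ConvolutionAlgebra α from x) f

theorem rightRegular_apply (f : ConvolutionAlgebra α) (x : RegularModule α) :
    rightRegular f x = mulRight f x := rfl

theorem norm_rightRegular_sq_le (f : ConvolutionAlgebra α) :
    ‖rightRegular f‖ ^ 2 ≤ ‖rightRegular (f * star f)‖ := by
  have : ‖rightRegular f‖ ≤ √‖rightRegular (f * star f)‖ := by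
    refine ContinuousLinearMap.opNorm_le_bound _ (Real.sqrt_nonneg _) fun x => ?_
    rw [← Real.sqrt_sq (norm_nonneg x), ← Real.sqrt_mul (norm_nonneg _)]
    refine Real.le_sqrt_of_sq_le ?_
    have h1 : (inner A (rightRegular f x) (rightRegular f x) : A)
        = inner A (rightRegular (f * star f) x) x := by
      rw [rightRegular_apply, inner_mulRight, rightRegular_apply]
      exact congrArg (inner A · x) (mul_assoc (show ConvolutionAlgebra α from x) f (star f))
    rw [CStarModule.norm_sq_eq (A := A), h1]
    calc _ ≤ ‖rightRegular (f * star f) x‖ * ‖x‖ := CStarModule.norm_inner_le _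
      _ ≤ ‖rightRegular (f * star f)‖ * ‖x‖ * ‖x‖ := by
        gcongr; exact ContinuousLinearMap.le_opNorm _ _
      _ = _ := by ring
  exact (Real.le_sqrt (norm_nonneg _) (norm_nonneg _)).1 this

theorem norm_rightRegular_mul_le (f g : ConvolutionAlgebra α) :
    ‖rightRegular (f * g)‖ ≤ ‖rightRegular f‖ * ‖rightRegular g‖ := by
  have : rightRegular (f * g) = (rightRegular g).comp (rightRegular f) :=
    ContinuousLinearMap.ext fun x => (mul_assoc (show ConvolutionAlgebra α from x) f g).symm
  rw [this, mul_comm]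
  exact ContinuousLinearMap.opNorm_comp_le _ _

theorem norm_rightRegular_le_star (f : ConvolutionAlgebra α) :
    ‖rightRegular f‖ ≤ ‖rightRegular (star f)‖ := by
  have h := (norm_rightRegular_sq_le f).trans (norm_rightRegular_mul_le f (star f))
  rcases (norm_nonneg (rightRegular f)).eq_or_lt with h0 | h0
  · rw [← h0]; exact norm_nonneg _
  · rw [sq] at h; exact le_of_mul_le_mul_left h h0

theorem norm_rightRegular_star (f : ConvolutionAlgebra α) :
    ‖rightRegular (star f)‖ = ‖rightRegular f‖ :=
  le_antisymm (by simpa using norm_rightRegular_le_star (star f)) (norm_rightRegular_le_star f)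

/-- The operator norm of the right regular representation. The latter is an anti-homomorphism,
which does not affect the C⋆-identity. -/
def seminorm : Seminorm ℂ (ConvolutionAlgebra α) :=
  (normSeminorm ℂ (RegularModule α →L[ℂ] RegularModule α)).comp rightRegular

theorem seminorm_apply (f : ConvolutionAlgebra α) : seminorm f = ‖rightRegular f‖ := rfl

theorem isBoundedCStarSeminorm_seminorm :
    IsBoundedCStarSeminorm (seminorm : Seminorm ℂ (ConvolutionAlgebra α)) where
  mul_le := norm_rightRegular_mul_le
  star_mul_self f := by
    simp only [seminorm_apply]
    refine le_antisymm ((norm_rightRegular_mul_le _ _).trans_eq ?_) ?_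
    · rw [norm_rightRegular_star]
    · have := norm_rightRegular_sq_le (star f)
      rwa [star_star, norm_rightRegular_star, sq] at this
  le_l1Norm f := LinearMap.mkContinuous_norm_le _ (l1Norm_nonneg f) (norm_mulRight_le f)

/-- The regular representation is dominated by the universal norm. -/
theorem norm_mulRight_le_norm (f : ConvolutionAlgebra α) (x : RegularModule α) :
    ‖mulRight f x‖ ≤ ‖f‖ * ‖x‖ :=
  (ContinuousLinearMap.le_opNorm (rightRegular f) x).trans
    (mul_le_mul_of_nonneg_right
      (le_universalNorm ⟨seminorm, isBoundedCStarSeminorm_seminorm⟩ f) (norm_nonneg x))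

end RegularModule

/-! ### Spectral subspaces -/

namespace CircleAction

variable {A : Type*} [CStarAlgebra A] (α : CircleAction A)

/-- The spectral subspace of a circle action for the character `ζ ↦ ζ ^ k`. -/
def spectralSubspace (k : ℤ) : Submodule ℂ A where
  carrier := {a | ∀ ζ : Circle, α ζ a = ((ζ ^ k : Circle) : ℂ) • a}
  add_mem' ha hb ζ := by rw [map_add, ha ζ, hb ζ, smul_add]
  zero_mem' ζ := by simp
  smul_mem' c a ha ζ := by rw [map_smul, ha ζ, smul_comm]

variable {α}

theorem mem_spectralSubspace {k : ℤ} {a : A} :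
    a ∈ α.spectralSubspace k ↔ ∀ ζ : Circle, α ζ a = ((ζ ^ k : Circle) : ℂ) • a := Iff.rfl

theorem one_mem_spectralSubspace : (1 : A) ∈ α.spectralSubspace 0 := fun ζ => by simp

theorem mul_mem_spectralSubspace {j k : ℤ} {a b : A} (ha : a ∈ α.spectralSubspace j)
    (hb : b ∈ α.spectralSubspace k) : a * b ∈ α.spectralSubspace (j + k) := fun ζ => by
  rw [map_mul, ha ζ, hb ζ, smul_mul_smul_comm, zpow_add, Circle.coe_mul]

theorem star_mem_spectralSubspace {k : ℤ} {a : A} (ha : a ∈ α.spectralSubspace k) :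
    star a ∈ α.spectralSubspace (-k) := fun ζ => by
  rw [map_star, ha ζ, star_smul, zpow_neg, Circle.coe_inv_eq_conj, starRingEnd_apply]

end CircleAction

namespace ConvolutionAlgebra

variable {A : Type*} [CStarAlgebra A] {α : CircleAction A}

variable (α) in
/-- The function `ζ ↦ ζ ^ m a` on the circle. -/
def monomial (m : ℤ) (a : A) : ConvolutionAlgebra α :=
  modulate m (ContinuousMap.const Circle a : C(Circle, A))

theorem monomial_apply (m : ℤ) (a : A) (s : Circle) :
    monomial α m a s = ((s ^ m : Circle) : ℂ) • a := rfl

theorem modulate_monomial (n m : ℤ) (a : A) :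
    modulate n (monomial α m a) = monomial α (n + m) a := modulate_modulate n m _

theorem star_monomial_one (m : ℤ) : star (monomial α m 1) = monomial α m 1 := by
  ext s
  simp [star_apply, monomial_apply, ← Circle.coe_inv_eq_conj]

/-- The convolution is easy to evaluate because its integrand
`t ↦ t ^ (m - k) α_t((t⁻¹ s) ^ m a)` is constant. -/
theorem monomial_one_mul_monomial {k : ℤ} {a : A} (ha : a ∈ α.spectralSubspace k) (m : ℤ) :
    monomial α (m - k) 1 * monomial α m a = monomial α m a := by
  ext s
  rw [mul_apply]
  have : ∀ t : Circle, monomial α (m - k) 1 t * α t (monomial α m a (t⁻¹ * s))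
      = monomial α m a s := fun t => by
    simp only [monomial_apply, map_smul, ha t, smul_mul_assoc, one_mul, smul_smul,
      ← Circle.coe_mul]
    refine congrArg (fun z : Circle => (z : ℂ) • a) ?_
    rw [mul_zpow, inv_zpow, zpow_sub]
    generalize t ^ m = x, t ^ k = y, s ^ m = z
    rw [mul_assoc, mul_assoc, mul_comm z y, ← mul_assoc x⁻¹, mul_comm x⁻¹, mul_assoc y]
    simp
  simp [this]

theorem norm_le_l1Norm (f : ConvolutionAlgebra α) : ‖f‖ ≤ l1Norm f :=
  ciSup_le fun p => p.2.le_l1Norm f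

theorem l1Norm_monomial (m : ℤ) (a : A) : l1Norm (monomial α m a) = ‖a‖ := by
  refine (l1Norm_modulate m _).trans ?_
  exact (integral_const ‖a‖).trans (by simp)

/-- Homogeneous elements keep their norm in the crossed product: in the regular representation,
`monomial m a` maps a unit vector to a vector of norm `‖a‖`. -/
theorem norm_monomial {k : ℤ} {a : A} (ha : a ∈ α.spectralSubspace k) (m : ℤ) :
    ‖monomial α m a‖ = ‖a‖ := by
  refine le_antisymm ((norm_le_l1Norm _).trans_eq (l1Norm_monomial m a)) ?_
  let := CStarAlgebra.spectralOrder A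
  have := CStarAlgebra.spectralOrderedRing A
  have h2 : ∀ (m : ℤ) (b : A),
      ‖(RegularModule.of (monomial α m b))‖ = ‖b‖ := fun m b => by
    have : ∀ t : Circle, monomial α m b t * star (monomial α m b t) = b * star b := fun t => by
      simp only [monomial_apply, star_smul, smul_mul_smul_comm]
      have := Circle.coe_mul (t ^ m) (t ^ m)⁻¹
      rw [Circle.coe_inv_eq_conj, mul_inv_cancel, Circle.coe_one] at this
      rw [← starRingEnd_apply, ← this, one_smul]
    have h3 : (inner A (RegularModule.of (monomial α m b))
        (RegularModule.of (monomial α m b)) : A) = b * star b := by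
      rw [RegularModule.inner_eq_integral]
      refine (integral_congr_ae (ae_of_all _ this)).trans ?_
      simp
    rw [CStarModule.norm_eq_sqrt_norm_inner_self (A := A), h3, CStarRing.norm_self_mul_star,
      Real.sqrt_mul_self (norm_nonneg b)]
  have h := RegularModule.norm_mulRight_le_norm (monomial α m a)
    (RegularModule.of (monomial α (m - k) 1))
  have h' : RegularModule.mulRight (monomial α m a) (RegularModule.of (monomial α (m - k) 1))
      = RegularModule.of (monomial α m a) := monomial_one_mul_monomial ha m
  rw [h', h2, h2] at h
  refine h.trans (mul_le_of_le_one_right (norm_nonneg _) ?_)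
  rcases subsingleton_or_nontrivial A with _ | _
  · simp [Subsingleton.elim (1 : A) 0]
  · exact CStarRing.norm_one.le

end ConvolutionAlgebra

/-! ### The embedding of `A` into the multiplier algebra of the crossed product -/

namespace ConvolutionAlgebra

variable {A : Type*} [CStarAlgebra A] {α : CircleAction A}

/-- Pointwise left multiplication by `a`. -/
def constMul (a : A) : ConvolutionAlgebra α →ₗ[ℂ] ConvolutionAlgebra α where
  toFun f := (⟨fun s => a * f s, continuous_const.mul f.continuous⟩ : C(Circle, A))
  map_add' f g := ext fun s => mul_add a (f s) (g s)
  map_smul' c f := ext fun s => mul_smul_comm c a (f s)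

theorem constMul_apply (a : A) (f : ConvolutionAlgebra α) (s : Circle) :
    constMul a f s = a * f s := rfl

theorem constMul_constMul (a b : A) (f : ConvolutionAlgebra α) :
    constMul a (constMul b f) = constMul (a * b) f :=
  ext fun s => (mul_assoc a b (f s)).symm

theorem star_constMul_mul (a : A) (f g : ConvolutionAlgebra α) :
    star (constMul a f) * g = star f * constMul (star a) g := by
  ext s
  simp only [mul_apply, star_apply, constMul_apply, star_mul, map_mul, mul_assoc]

theorem norm_constMul_of_mem_unitary {u : A} (hu : u ∈ unitary A) (f : ConvolutionAlgebra α) :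
    ‖constMul u f‖ = ‖f‖ := by
  refine iSup_congr fun p => ?_
  refine (mul_self_inj_of_nonneg (apply_nonneg _ _) (apply_nonneg _ _)).1 ?_
  rw [← p.2.star_mul_self, ← p.2.star_mul_self, star_constMul_mul, constMul_constMul,
    Unitary.star_mul_self_of_mem hu]
  congr 2
  ext s
  simp [constMul_apply]

/-- Left multiplication by `a` is bounded because `a` is a combination of four unitaries. The
constant `2` is not optimal; the optimal bound follows from automatic contractivity later. -/
theorem norm_constMul_le (a : A) (f : ConvolutionAlgebra α) :
    ‖constMul a f‖ ≤ 2 * ‖a‖ * ‖f‖ := by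
  obtain ⟨u, c, ha, hc⟩ := CStarAlgebra.exists_sum_four_unitary a
  have h : constMul a f = ∑ i, c i • constMul (u i : A) f := by
    conv_lhs => rw [ha]
    ext s
    have h2 : ∀ (F : Finset (Fin 4)), (∑ i ∈ F, c i • constMul (u i : A) f) s
        = ∑ i ∈ F, c i • ((u i : A) * f s) := fun F => by
      induction F using Finset.cons_induction with
      | empty => simp [zero_apply]
      | cons i F hi ih => rw [Finset.sum_cons, Finset.sum_cons, add_apply, ih]; rfl
    rw [h2, constMul_apply, Finset.sum_mul]
    simp only [smul_mul_assoc]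
  calc ‖constMul a f‖ ≤ ∑ i, ‖c i • constMul (u i : A) f‖ := h ▸ norm_sum_le _ _
    _ ≤ ∑ _i : Fin 4, ‖a‖ / 2 * ‖f‖ := by
      refine Finset.sum_le_sum fun i _ => ?_
      rw [norm_smul, norm_constMul_of_mem_unitary (u i).2]
      exact mul_le_mul_of_nonneg_right (hc i) (norm_nonneg f)
    _ = 2 * ‖a‖ * ‖f‖ := by simp; ring

theorem constMul_modulate (n : ℤ) (a : A) (f : ConvolutionAlgebra α) :
    constMul a (modulate n f) = modulate n (constMul a f) := by
  ext s; simp [constMul_apply, modulate_apply]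

theorem star_constMul_star_apply (a : A) (f : ConvolutionAlgebra α) (s : Circle) :
    star (constMul (star a) (star f)) s = f s * α s a := by
  rw [star_apply, constMul_apply, star_apply, star_mul, star_star, map_mul, inv_inv, ← map_star,
    star_star, ← α.map_mul_apply]
  simp

theorem constMul_monomial (a : A) (m : ℤ) (b : A) :
    constMul a (monomial α m b) = monomial α m (a * b) := by
  ext s; simp [constMul_apply, monomial_apply]

theorem star_constMul_star_monomial {k : ℤ} {a : A} (ha : a ∈ α.spectralSubspace k) (m : ℤ) :
    star (constMul (star a) (star (monomial α m 1))) = monomial α (m + k) a := by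
  ext s
  rw [star_constMul_star_apply, monomial_apply, monomial_apply, ha s, zpow_add, Circle.coe_mul,
    smul_mul_smul_comm, one_mul]

end ConvolutionAlgebra

namespace CrossedProduct

open ConvolutionAlgebra UniformSpace
open scoped MultiplierAlgebra

variable {A : Type*} [CStarAlgebra A] {α : CircleAction A}

/-- `of` as a continuous linear map. -/
def ofL : ConvolutionAlgebra α →L[ℂ] CrossedProduct α where
  toFun := of
  map_add' := of_add
  map_smul' := of_smul
  cont := continuous_of

/-- Left multiplication by an element of `A` on the crossed product. -/
def constMulL (a : A) : CrossedProduct α →L[ℂ] CrossedProduct α :=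
  (ofL.comp ((constMul a).mkContinuous (2 * ‖a‖) (norm_constMul_le a))).extend ofL

theorem constMulL_of (a : A) (f : ConvolutionAlgebra α) :
    constMulL a (of f) = of (constMul a f) :=
  ContinuousLinearMap.extend_eq _ denseRange_of (Completion.isUniformInducing_coe _) f

theorem constMulL_constMulL (a b : A) (x : CrossedProduct α) :
    constMulL a (constMulL b x) = constMulL (a * b) x := by
  induction x using induction_on with
  | hc => exact isClosed_eq (by fun_prop) (by fun_prop)
  | h f => simp only [constMulL_of, constMul_constMul]

theorem star_constMulL_mul (a : A) (x y : CrossedProduct α) :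
    star (constMulL a x) * y = star x * constMulL (star a) y := by
  induction x, y using induction_on₂ with
  | hc => exact isClosed_eq (by fun_prop) (by fun_prop)
  | h f g => simp only [constMulL_of, ← of_star, ← of_mul, star_constMul_mul]

/-- Right multiplication by an element of `A` on the crossed product. -/
def mulConstL (a : A) : CrossedProduct α →L[ℂ] CrossedProduct α where
  toFun x := star (constMulL (star a) (star x))
  map_add' x y := by simp
  map_smul' c x := by simp
  cont := by fun_prop

theorem mulConstL_apply (a : A) (x : CrossedProduct α) :
    mulConstL a x = star (constMulL (star a) (star x)) := rfl

theorem constMulL_one (x : CrossedProduct α) : constMulL 1 x = x := by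
  induction x using induction_on with
  | hc => exact isClosed_eq (by fun_prop) (by fun_prop)
  | h f => rw [constMulL_of]; congr 1; ext s; simp [constMul_apply]

theorem constMulL_add (a b : A) (x : CrossedProduct α) :
    constMulL (a + b) x = constMulL a x + constMulL b x := by
  induction x using induction_on with
  | hc => exact isClosed_eq (by fun_prop) (by fun_prop)
  | h f =>
    rw [constMulL_of, constMulL_of, constMulL_of, ← of_add]
    exact congrArg of (ConvolutionAlgebra.ext fun s => add_mul a b (f s))

theorem constMulL_smul (c : ℂ) (a : A) (x : CrossedProduct α) :
    constMulL (c • a) x = c • constMulL a x := by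
  induction x using induction_on with
  | hc => exact isClosed_eq (constMulL _).continuous
            ((continuous_smul' c).comp (constMulL a).continuous)
  | h f =>
    rw [constMulL_of, constMulL_of, ← of_smul]
    exact congrArg of (ConvolutionAlgebra.ext fun s => smul_mul_assoc c a (f s))

theorem constMulL_zero (x : CrossedProduct α) : constMulL 0 x = 0 := by
  rw [← zero_smul ℂ (0 : A), constMulL_smul, zero_smul]

variable (α) in
/-- The canonical embedding of `A` into the multiplier algebra of the crossed product, given by
`(a f)(s) = a f(s)` and `(f a)(s) = f(s) α_s(a)`. -/
def embed : A →⋆ₐ[ℂ] 𝓜(ℂ, CrossedProduct α) where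
  toFun a :=
    { fst := constMulL a
      snd := mulConstL a
      central := fun x y => by
        rw [mulConstL_apply, star_constMulL_mul, star_star, star_star] }
  map_one' := multiplier_ext (fun b => constMulL_one b)
    (fun b => by simp [mulConstL_apply, constMulL_one])
  map_mul' a b := multiplier_ext (fun x => by simp [constMulL_constMulL])
    (fun x => by simp [mulConstL_apply, constMulL_constMulL])
  map_zero' := multiplier_ext (fun b => constMulL_zero b)
    (fun b => by simp [mulConstL_apply, constMulL_zero])
  map_add' a b := multiplier_ext (fun x => by simp [constMulL_add])
    (fun x => by simp [mulConstL_apply, constMulL_add])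
  commutes' c := multiplier_ext
    (fun x => by simp [Algebra.algebraMap_eq_smul_one, constMulL_smul, constMulL_one])
    (fun x => by simp [Algebra.algebraMap_eq_smul_one, mulConstL_apply, constMulL_smul,
      constMulL_one])
  map_star' a := multiplier_ext (fun x => by simp [mulConstL_apply])
    (fun x => by simp [mulConstL_apply])

theorem embed_fst (a : A) (x : CrossedProduct α) : (embed α a).fst x = constMulL a x := rfl

theorem embed_snd (a : A) (x : CrossedProduct α) : (embed α a).snd x = mulConstL a x := rfl

theorem constMulL_dualMap (n : ℤ) (a : A) (x : CrossedProduct α) :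
    constMulL a (dualMap n x) = dualMap n (constMulL a x) := by
  induction x using induction_on with
  | hc => exact isClosed_eq ((constMulL a).continuous.comp (continuous_dualMap n))
            ((continuous_dualMap n).comp (constMulL a).continuous)
  | h f => simp only [dualMap_of, constMulL_of, constMul_modulate]

theorem multiplierMap_dualAut_embed (n : ℤ) (a : A) :
    multiplierMap (dualAut n) (embed α a) = embed α a := by
  have h : ∀ (a : A) (x : CrossedProduct α),
      dualAut n (constMulL a ((dualAut n).symm x)) = constMulL a x := fun a x => by
    have := constMulL_dualMap n a ((dualAut n).symm x)
    refine this.symm.trans (congrArg (constMulL a) ?_)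
    exact (dualAut n).apply_symm_apply x
  refine multiplier_ext (h a) fun x => ?_
  change dualAut n (star (constMulL (star a) (star ((dualAut n).symm x)))) = _
  rw [map_star, ← map_star (dualAut n).symm, h]
  rfl

end CrossedProduct

/-! ### Multipliers of a C⋆-algebra -/

section Multiplier

open scoped MultiplierAlgebra

variable {B : Type*} [NonUnitalCStarAlgebra B]

/-- A C⋆-algebra as a ⋆-subalgebra of its multiplier algebra. -/
abbrev coeMultiplier : B →⋆ₙₐ[ℂ] 𝓜(ℂ, B) := DoubleCentralizer.coeHom

theorem eq_of_forall_mul_left_eq {x y : B} (h : ∀ d, d * x = d * y) : x = y := by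
  have := h (star (x - y))
  rw [← sub_eq_zero, ← mul_sub, CStarRing.star_mul_self_eq_zero_iff] at this
  exact sub_eq_zero.1 this

theorem eq_of_forall_mul_right_eq {x y : B} (h : ∀ d, x * d = y * d) : x = y := by
  have := h (star (x - y))
  rw [← sub_eq_zero, ← sub_mul, CStarRing.mul_star_self_eq_zero_iff] at this
  exact sub_eq_zero.1 this

theorem mul_coeMultiplier (x : 𝓜(ℂ, B)) (b : B) :
    x * coeMultiplier b = coeMultiplier (x.fst b) := by
  refine multiplier_ext (fun c => ?_) (fun c => x.central c b)
  change x.fst (b * c) = x.fst b * c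
  refine eq_of_forall_mul_left_eq fun d => ?_
  rw [← x.central, ← mul_assoc, ← mul_assoc, x.central]

theorem coeMultiplier_mul (x : 𝓜(ℂ, B)) (b : B) :
    coeMultiplier b * x = coeMultiplier (x.snd b) := by
  refine multiplier_ext (fun c => (x.central b c).symm) (fun c => ?_)
  change x.snd (c * b) = c * x.snd b
  refine eq_of_forall_mul_right_eq fun d => ?_
  rw [x.central, mul_assoc, mul_assoc, x.central]

theorem norm_coeMultiplier (b : B) : ‖(coeMultiplier b : 𝓜(ℂ, B))‖ = ‖b‖ := by
  refine NonUnitalStarAlgHom.norm_map _ (fun b c h => ?_) b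
  exact eq_of_forall_mul_right_eq fun d =>
    congrArg (fun x : 𝓜(ℂ, B) => x.fst d) h

theorem multiplierMap_coeMultiplier (β : B ≃⋆ₐ[ℂ] B) (b : B) :
    multiplierMap β (coeMultiplier b) = coeMultiplier (β b) := by
  refine multiplier_ext (fun c => ?_) (fun c => ?_)
  · change β (b * β.symm c) = β b * c
    simp
  · change β (β.symm c * b) = c * β b
    simp

end Multiplier

/-! ### From the Rokhlin property to approximate representability -/

theorem norm_le_one_of_mem_unitary {D : Type*} [CStarAlgebra D] {u : D} (hu : u ∈ unitary D) :
    ‖u‖ ≤ 1 := by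
  rcases subsingleton_or_nontrivial D with _ | _
  · simp [Subsingleton.elim u 0]
  · exact (CStarRing.norm_of_mem_unitary hu).le

/-- For a uniformly Lipschitz sequence of maps, the set of points where it tends to `0` is
closed. -/
theorem isClosed_setOf_tendsto_norm_zero {E F : Type*} [SeminormedAddCommGroup E]
    [SeminormedAddCommGroup F] (T : ℕ → E → F) (C : ℝ)
    (hT : ∀ n x y, ‖T n x - T n y‖ ≤ C * ‖x - y‖) :
    IsClosed {x | Tendsto (fun n => ‖T n x‖) atTop (𝓝 0)} := by
  refine isClosed_of_closure_subset fun x hx => ?_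
  refine Metric.tendsto_atTop.2 fun ε hε => ?_
  obtain ⟨y, hy, hxy⟩ := Metric.mem_closure_iff.1 hx (ε / (2 * (|C| + 1))) (by positivity)
  obtain ⟨N, hN⟩ := Metric.tendsto_atTop.1 hy (ε / 2) (by positivity)
  refine ⟨N, fun n hn => ?_⟩
  have h1 := hN n hn
  rw [Real.dist_eq, sub_zero, abs_norm] at h1 ⊢
  rw [dist_eq_norm, lt_div_iff₀ (by positivity)] at hxy
  have h2 : C * ‖x - y‖ ≤ (|C| + 1) * ‖x - y‖ :=
    mul_le_mul_of_nonneg_right ((le_abs_self C).trans (by linarith)) (norm_nonneg _)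
  have h3 : ‖T n x‖ ≤ ‖T n x - T n y‖ + ‖T n y‖ := by
    simpa using norm_add_le (T n x - T n y) (T n y)
  linarith [hT n x y]

namespace CircleAction

variable {A : Type*} [CStarAlgebra A] {α : CircleAction A}

/-- In a separable algebra the Rokhlin property yields an asymptotically central sequence of
unitaries. -/
theorem HasRokhlinProperty.exists_seq [TopologicalSpace.SeparableSpace A]
    (h : α.HasRokhlinProperty) : ∃ u : ℕ → A, (∀ n, u n ∈ unitary A) ∧
      (∀ n (ζ : Circle), ‖α ζ (u n) - (ζ : ℂ) • u n‖ ≤ 1 / (n + 1 : ℝ)) ∧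
      ∀ a, Tendsto (fun n => ‖u n * a - a * u n‖) atTop (𝓝 0) := by
  classical
  let d := TopologicalSpace.denseSeq A
  choose u hu hα hF using fun n : ℕ => h (1 / (n + 1 : ℝ)) (by positivity)
    ((Finset.range (n + 1)).image d)
  refine ⟨u, hu, fun n ζ => (hα n ζ).le, ?_⟩
  have hc := isClosed_setOf_tendsto_norm_zero (fun n a => u n * a - a * u n) 2 fun n x y => by
    have : u n * x - x * u n - (u n * y - y * u n) = u n * (x - y) - (x - y) * u n := by
      noncomm_ring
    have h1 := norm_le_one_of_mem_unitary (hu n)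
    have h0 := norm_nonneg (x - y)
    rw [this]
    refine (norm_sub_le _ _).trans ?_
    have h2 := (norm_mul_le (u n) (x - y)).trans (mul_le_of_le_one_left h0 h1)
    have h3 := (norm_mul_le (x - y) (u n)).trans (mul_le_of_le_one_right h0 h1)
    linarith
  refine fun a => hc.closure_subset_iff.2 ?_ (TopologicalSpace.denseRange_denseSeq A a)
  rintro _ ⟨k, rfl⟩
  refine squeeze_zero' (Eventually.of_forall fun n => norm_nonneg _) ?_
    tendsto_one_div_add_atTop_nhds_zero_nat
  filter_upwards [eventually_ge_atTop k] with n hn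
  exact (hF n (d k) (Finset.mem_image_of_mem d (Finset.mem_range.2 (by omega)))).le

end CircleAction

namespace CrossedProduct

open ConvolutionAlgebra
open scoped MultiplierAlgebra

variable {A : Type*} [CStarAlgebra A] {α : CircleAction A}

theorem embed_mem_fixedMultipliers (n : ℤ) (a : A) :
    embed α a ∈ fixedMultipliers (dualAut (α := α) n) :=
  multiplierMap_dualAut_embed n a

/-- The estimate showing that conjugation by `u⋆` approximates the dual automorphism: its value at
`s` is the defect of `u f(s) ≈ f(s) u` plus that of `α_s(u) ≈ s u`. -/
theorem norm_dualMap_sub_conj_le {u : A} (hu : u ∈ unitary A) {δ : ℝ}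
    (hδ : ∀ ζ : Circle, ‖α ζ u - (ζ : ℂ) • u‖ ≤ δ) (f : ConvolutionAlgebra α) :
    ‖dualMap 1 (of f) - mulConstL u (constMulL (star u) (of f))‖
      ≤ ∫ s, (‖u * f s - f s * u‖ + ‖f s‖ * δ) ∂circleHaar := by
  set g := modulate 1 f - star (constMul (star u) (star (constMul (star u) f)))
  have h1 : dualMap 1 (of f) - mulConstL u (constMulL (star u) (of f)) = of g := by
    rw [dualMap_of, mulConstL_apply, constMulL_of, ← of_star, constMulL_of, ← of_star]
    exact (map_sub ofHom _ _).symm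
  rw [h1, norm_of]
  refine (norm_le_l1Norm g).trans ?_
  have hf := f.continuous
  refine integral_mono (integrable_circleHaar g.continuous.norm) (integrable_circleHaar ?_) ?_
  · exact ((continuous_const.mul hf).sub (hf.mul continuous_const)).norm.add
      (hf.norm.mul continuous_const)
  refine fun s => ?_
  have h2 : g s = star u * ((s : ℂ) • (u * f s - f s * u) - f s * (α s u - (s : ℂ) • u)) := by
    have h3 : g s = ((s ^ (1 : ℤ) : Circle) : ℂ) • f s - star u * f s * α s u := by
      rw [← constMul_apply, ← star_constMul_star_apply]; rfl
    rw [h3, zpow_one, mul_sub, mul_sub, mul_smul_comm, mul_sub, ← mul_assoc (star u) u,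
      Unitary.star_mul_self_of_mem hu, one_mul, mul_smul_comm, mul_sub, mul_smul_comm, smul_sub]
    simp only [mul_assoc]
    abel
  have h0 := norm_le_one_of_mem_unitary (Unitary.star_mem hu)
  change ‖g s‖ ≤ ‖u * f s - f s * u‖ + ‖f s‖ * δ
  rw [h2]
  calc _ ≤ ‖(s : ℂ) • (u * f s - f s * u) - f s * (α s u - (s : ℂ) • u)‖ :=
        (norm_mul_le _ _).trans (mul_le_of_le_one_left (norm_nonneg _) h0)
    _ ≤ ‖(s : ℂ) • (u * f s - f s * u)‖ + ‖f s * (α s u - (s : ℂ) • u)‖ := norm_sub_le _ _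
    _ ≤ _ := by
      rw [norm_smul, Circle.norm_coe, one_mul]
      gcongr
      exact (norm_mul_le _ _).trans (mul_le_mul_of_nonneg_left (hδ s) (norm_nonneg _))

theorem norm_constMulL_apply_le (a : A) (x : CrossedProduct α) :
    ‖constMulL a x‖ ≤ ‖a‖ * ‖x‖ := by
  refine ((embed α a).fst.le_opNorm x).trans (mul_le_mul_of_nonneg_right ?_ (norm_nonneg x))
  rw [DoubleCentralizer.norm_fst]
  exact NonUnitalStarAlgHom.norm_apply_le (embed α) a

theorem norm_mulConstL_apply_le (a : A) (x : CrossedProduct α) :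
    ‖mulConstL a x‖ ≤ ‖a‖ * ‖x‖ := by
  rw [mulConstL_apply, norm_star, ← norm_star a, ← norm_star x]
  exact norm_constMulL_apply_le _ _

theorem tendsto_norm_dualMap_sub_conj {u : ℕ → A} (hu : ∀ n, u n ∈ unitary A)
    (hα : ∀ n (ζ : Circle), ‖α ζ (u n) - (ζ : ℂ) • u n‖ ≤ 1 / (n + 1 : ℝ))
    (hc : ∀ a, Tendsto (fun n => ‖u n * a - a * u n‖) atTop (𝓝 0)) (b : CrossedProduct α) :
    Tendsto (fun n => ‖dualMap 1 b - mulConstL (u n) (constMulL (star (u n)) b)‖) atTop (𝓝 0) := by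
  have hcl := isClosed_setOf_tendsto_norm_zero
    (fun n b => dualAut (α := α) 1 b - mulConstL (u n) (constMulL (star (u n)) b)) 2
    fun n x y => by
      rw [sub_sub_sub_comm, ← map_sub, ← map_sub, ← map_sub]
      have h0 := norm_nonneg (x - y)
      have h1 := norm_mulConstL_apply_le (u n) (constMulL (star (u n)) (x - y))
      have h2 := norm_constMulL_apply_le (star (u n)) (x - y)
      rw [norm_star] at h2
      have h3 := norm_le_one_of_mem_unitary (hu n)
      have h4 : ‖mulConstL (u n) (constMulL (star (u n)) (x - y))‖ ≤ ‖x - y‖ :=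
        (h1.trans (mul_le_of_le_one_left (norm_nonneg _) h3)).trans
          (h2.trans (mul_le_of_le_one_left h0 h3))
      have h5 := StarAlgEquiv.norm_map (dualAut (α := α) 1) (x - y)
      refine (norm_sub_le _ _).trans ?_
      linarith
  refine induction_on b hcl fun f => ?_
  refine squeeze_zero (fun n => norm_nonneg _)
    (fun n => norm_dualMap_sub_conj_le (hu n) (hα n) f) ?_
  have hf := f.continuous
  have h0 : ∫ _s : Circle, (0 : ℝ) ∂circleHaar = 0 := integral_zero _ _
  rw [← h0]
  refine tendsto_integral_of_dominated_convergence (fun s => 3 * ‖f s‖) (fun n => ?_)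
    ((integrable_circleHaar hf.norm).const_mul 3) (fun n => ae_of_all _ fun s => ?_)
    (ae_of_all _ fun s => ?_)
  · exact (((continuous_const.mul hf).sub (hf.mul continuous_const)).norm.add
      (hf.norm.mul continuous_const)).aestronglyMeasurable
  · rw [Real.norm_of_nonneg (by positivity)]
    have h1 := norm_le_one_of_mem_unitary (hu n)
    have h0 := norm_nonneg (f s)
    have h2 := (norm_mul_le (u n) (f s)).trans (mul_le_of_le_one_left h0 h1)
    have h3 := (norm_mul_le (f s) (u n)).trans (mul_le_of_le_one_right h0 h1)
    have h4 : ‖f s‖ * (1 / (n + 1 : ℝ)) ≤ ‖f s‖ := by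
      refine mul_le_of_le_one_right h0 ?_
      rw [div_le_one (by positivity)]
      linarith [Nat.cast_nonneg (α := ℝ) n]
    linarith [norm_sub_le (u n * f s) (f s * u n)]
  · simpa using (hc (f s)).add (tendsto_one_div_add_atTop_nhds_zero_nat.const_mul ‖f s‖)

theorem isApproximatelyRepresentable_of_hasRokhlinProperty [TopologicalSpace.SeparableSpace A]
    (h : α.HasRokhlinProperty) : IsApproximatelyRepresentable (dualAut (α := α) 1) := by
  obtain ⟨u, hu, hα, hc⟩ := h.exists_seq
  let y : ℕ → fixedMultipliers (dualAut (α := α) 1) := fun n =>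
    ⟨embed α (star (u n)), embed_mem_fixedMultipliers 1 _⟩
  have hy : ∀ n, y n ∈ unitary (fixedMultipliers (dualAut (α := α) 1)) := fun n => by
    have h := Unitary.map_mem (embed α) (Unitary.star_mem (hu n))
    exact ⟨Subtype.ext h.1, Subtype.ext h.2⟩
  let x : ℕ →ᵇ fixedMultipliers (dualAut (α := α) 1) :=
    BoundedContinuousFunction.ofNormedAddCommGroup y continuous_of_discreteTopology 1
      fun n => norm_le_one_of_mem_unitary (hy n)
  refine ⟨Ideal.Quotient.mk _ x, ⟨?_, ?_⟩, fun b => ?_⟩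
  · rw [SequenceAlgebra.star_mk, ← map_mul, ← map_one (Ideal.Quotient.mk _)]
    exact congrArg _ (BoundedContinuousFunction.ext fun n => (hy n).1)
  · rw [SequenceAlgebra.star_mk, ← map_mul, ← map_one (Ideal.Quotient.mk _)]
    exact congrArg _ (BoundedContinuousFunction.ext fun n => (hy n).2)
  · refine (Ideal.Quotient.mk_eq_mk_iff_sub_mem _ _).2 ?_
    change Tendsto (fun n => ‖coeMultiplier (dualAut 1 b) - embed α (star (u n)) * coeMultiplier b *
      star (embed α (star (u n)))‖) atTop (𝓝 0)
    have : ∀ n, coeMultiplier (dualAut 1 b) - embed α (star (u n)) * coeMultiplier b *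
      star (embed α (star (u n)))
        = coeMultiplier (dualMap 1 b - mulConstL (u n) (constMulL (star (u n)) b)) := fun n => by
      rw [mul_coeMultiplier, ← map_star, star_star, coeMultiplier_mul, map_sub]
      rfl
    simp only [this, norm_coeMultiplier]
    exact tendsto_norm_dualMap_sub_conj hu hα hc b

end CrossedProduct

/-! ### Fourier coefficients of a circle action -/

/-- The character `ζ ↦ ζ ^ k` of the circle as a continuous function. -/
def circleCharacter (k : ℤ) : C(Circle, ℂ) where
  toFun ζ := ((ζ ^ k : Circle) : ℂ)
  continuous_toFun :=
    (show Continuous fun z : Circle => (z : ℂ) by fun_prop).comp (continuous_zpow k)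

theorem circleCharacter_apply (k : ℤ) (ζ : Circle) :
    circleCharacter k ζ = ((ζ ^ k : Circle) : ℂ) := rfl

/-- The ⋆-algebra of trigonometric polynomials. -/
def trigPolynomials : StarSubalgebra ℂ C(Circle, ℂ) where
  toSubalgebra := Algebra.adjoin ℂ (Set.range circleCharacter)
  star_mem' := by
    change Algebra.adjoin ℂ (Set.range circleCharacter)
      ≤ star (Algebra.adjoin ℂ (Set.range circleCharacter))
    refine Algebra.adjoin_le ?_
    rintro _ ⟨k, rfl⟩
    refine Algebra.subset_adjoin ⟨-k, ?_⟩
    ext ζ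
    simp [circleCharacter_apply, ← Circle.coe_inv_eq_conj]

theorem trigPolynomials_coe :
    Subalgebra.toSubmodule trigPolynomials.toSubalgebra
      = Submodule.span ℂ (Set.range circleCharacter) := by
  refine Algebra.adjoin_eq_span_of_subset ℂ (Set.Subset.trans ?_ Submodule.subset_span)
  intro x hx
  refine Submonoid.closure_induction (fun _ => id) ⟨0, ?_⟩ ?_ hx
  · ext ζ
    simp [circleCharacter_apply]
  · rintro _ _ _ _ ⟨j, rfl⟩ ⟨k, rfl⟩
    refine ⟨j + k, ?_⟩
    ext ζ
    simp [circleCharacter_apply, zpow_add]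

theorem span_circleCharacter_topologicalClosure :
    (Submodule.span ℂ (Set.range circleCharacter)).topologicalClosure = ⊤ := by
  have h := ContinuousMap.starSubalgebra_topologicalClosure_eq_top_of_separatesPoints
    trigPolynomials (by
      intro x y hxy
      refine ⟨_, ⟨circleCharacter 1, Algebra.subset_adjoin ⟨1, rfl⟩, rfl⟩, ?_⟩
      simpa [circleCharacter_apply] using fun h => hxy (Circle.coe_injective h))
  rw [← trigPolynomials_coe]
  refine eq_top_iff.2 fun x _ => ?_
  have : x ∈ trigPolynomials.topologicalClosure := h ▸ trivial
  exact this

/-- A continuous function on the circle all of whose Fourier coefficients vanish is zero. -/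
theorem eq_zero_of_forall_integral_circleCharacter {h : Circle → ℂ} (hh : Continuous h)
    (h0 : ∀ k : ℤ, ∫ z, circleCharacter k z * h z ∂circleHaar = 0) : h = 0 := by
  have hi : ∀ q : C(Circle, ℂ), Integrable (fun z => q z * h z) circleHaar := fun q =>
    integrable_circleHaar (q.continuous.mul hh)
  let Λ : C(Circle, ℂ) →ₗ[ℂ] ℂ :=
    { toFun := fun q => ∫ z, q z * h z ∂circleHaar
      map_add' := fun p q => by
        simp only [ContinuousMap.add_apply, add_mul]
        exact integral_add (hi p) (hi q)
      map_smul' := fun c q => by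
        simp only [ContinuousMap.smul_apply, smul_mul_assoc]
        exact integral_smul _ _ }
  have hΛ : Continuous Λ := AddMonoidHomClass.continuous_of_bound Λ (∫ z, ‖h z‖ ∂circleHaar)
    fun q => by
      refine (norm_integral_le_of_norm_le ((integrable_circleHaar hh.norm).mul_const ‖q‖)
        (ae_of_all _ fun z => ?_)).trans_eq (integral_mul_const _ _)
      rw [norm_mul, mul_comm]
      exact mul_le_mul_of_nonneg_left (q.norm_coe_le_norm z) (norm_nonneg _)
  have hspan : Submodule.span ℂ (Set.range circleCharacter) ≤ LinearMap.ker Λ := by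
    refine Submodule.span_le.2 ?_
    rintro _ ⟨k, rfl⟩
    exact h0 k
  have hcl : IsClosed (LinearMap.ker Λ : Set C(Circle, ℂ)) :=
    isClosed_eq hΛ continuous_const
  have htop := Submodule.topologicalClosure_minimal _ hspan hcl
  rw [span_circleCharacter_topologicalClosure] at htop
  have h1 : Λ (star ⟨h, hh⟩) = 0 := htop trivial
  let := CStarAlgebra.spectralOrder ℂ
  have := CStarAlgebra.spectralOrderedRing ℂ
  have h2 := eq_zero_of_integral_circleHaar_eq_zero (f := fun z => star (h z) * h z)
    (hh.star.mul hh) (fun z => star_mul_self_nonneg _) h1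
  exact funext fun z => CStarRing.star_mul_self_eq_zero_iff _ |>.1 (congrFun h2 z)

namespace CircleAction

variable {A : Type*} [CStarAlgebra A] (α : CircleAction A)

/-- The `k`-th Fourier coefficient `∫ ζ ^ (-k) α_ζ(a) dζ` of `a`. -/
def fourierCoefficient (k : ℤ) (a : A) : A :=
  ∫ ζ, ((ζ ^ (-k) : Circle) : ℂ) • α ζ a ∂circleHaar

theorem continuous_fourierCoefficient_integrand (k : ℤ) (a : A) :
    Continuous fun ζ : Circle => ((ζ ^ (-k) : Circle) : ℂ) • α ζ a :=
  (circleCharacter (-k)).continuous.smul (α.continuous_apply a)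

theorem fourierCoefficient_mem (k : ℤ) (a : A) :
    α.fourierCoefficient k a ∈ α.spectralSubspace k := fun η => by
  rw [fourierCoefficient, α.map_integral η (α.continuous_fourierCoefficient_integrand k a),
    ← integral_smul, ← integral_mul_left_eq_self _ η⁻¹]
  refine integral_congr_ae (ae_of_all _ fun ζ => ?_)
  simp only [map_smul, ← α.map_mul_apply, mul_inv_cancel_left, smul_smul, ← Circle.coe_mul]
  rw [mul_zpow, inv_zpow, zpow_neg, inv_inv]

theorem isClosed_spectralSubspace (k : ℤ) : IsClosed (α.spectralSubspace k : Set A) := by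
  have : (α.spectralSubspace k : Set A)
      = ⋂ ζ : Circle, {a | α ζ a = ((ζ ^ k : Circle) : ℂ) • a} := by
    ext a; simp [mem_spectralSubspace]
  rw [this]
  exact isClosed_iInter fun ζ => isClosed_eq (α.clm ζ).continuous (continuous_const_smul _)

/-- The homogeneous elements span a dense subspace: a continuous functional that vanishes on all
of them has, along each orbit, only zero Fourier coefficients. -/
theorem iSup_spectralSubspace_topologicalClosure :
    (⨆ k, α.spectralSubspace k).topologicalClosure = ⊤ := by
  set S := (⨆ k, α.spectralSubspace k).topologicalClosure
  have : IsClosed (S : Set A) := Submodule.isClosed_topologicalClosure _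
  refine eq_top_iff.2 fun a _ => ?_
  rw [← Submodule.Quotient.mk_eq_zero]
  refine (SeparatingDual.eq_zero_iff_forall_dual_eq_zero (R := ℂ) _).2 fun g => ?_
  let φ : A →L[ℂ] ℂ := g.comp S.mkQL
  have hφ : ∀ k, ∀ b ∈ α.spectralSubspace k, φ b = 0 := fun k b hb => by
    have hb' : b ∈ S := Submodule.le_topologicalClosure _ (Submodule.mem_iSup_of_mem k hb)
    have : S.mkQL b = 0 := (Submodule.Quotient.mk_eq_zero S).2 hb'
    simp [φ, this]
  have h := eq_zero_of_forall_integral_circleCharacter (h := fun ζ => φ (α ζ a))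
    (φ.continuous.comp (α.continuous_apply a)) fun k => by
      have h1 := hφ (-k) _ (α.fourierCoefficient_mem (-k) a)
      rw [fourierCoefficient, ← φ.integral_comp_comm
        (integrable_circleHaar (α.continuous_fourierCoefficient_integrand _ a))] at h1
      simpa [circleCharacter_apply] using h1
  have h1 : φ (α 1 a) = 0 := congrFun h 1
  rwa [map_one] at h1

end CircleAction

/-! ### Projections and corners of the crossed product -/

namespace CrossedProduct

open ConvolutionAlgebra

variable {A : Type*} [CStarAlgebra A] {α : CircleAction A}

variable (α) in
/-- The projections `ζ ↦ ζ ^ m` in the crossed product, which belong to the canonical copy of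
`C⋆(𝕋)`. They are permuted by the dual action. -/
def proj (m : ℤ) : CrossedProduct α := of (monomial α m 1)

theorem constMulL_proj (a : A) (m : ℤ) : constMulL a (proj α m) = of (monomial α m a) := by
  rw [proj, constMulL_of, constMul_monomial, mul_one]

theorem mulConstL_proj {k : ℤ} {a : A} (ha : a ∈ α.spectralSubspace k) (m : ℤ) :
    mulConstL a (proj α m) = of (monomial α (m + k) a) := by
  rw [mulConstL_apply, proj, ← of_star, constMulL_of, ← of_star, star_constMul_star_monomial ha]

theorem proj_mul_proj (m : ℤ) : proj α m * proj α m = proj α m := by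
  rw [proj, ← of_mul]
  have := monomial_one_mul_monomial (α := α) CircleAction.one_mem_spectralSubspace m
  rw [sub_zero] at this
  rw [this]

theorem star_proj (m : ℤ) : star (proj α m) = proj α m := by
  rw [proj, ← of_star, star_monomial_one]

theorem norm_of_monomial {k : ℤ} {a : A} (ha : a ∈ α.spectralSubspace k) (m : ℤ) :
    ‖of (monomial α m a)‖ = ‖a‖ := by
  rw [norm_of, norm_monomial ha]

theorem dualMap_monomial (n m : ℤ) (a : A) :
    dualMap n (of (monomial α m a)) = of (monomial α (n + m) a) := by
  rw [dualMap_of, modulate_monomial]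

/-- The off-diagonal corner `p₁ (A ⋊ 𝕋) p₀` consists of the elements `a p₀` with `a` homogeneous of
degree `-1`. -/
theorem exists_proj_one_mul_mul_proj_zero (b : CrossedProduct α) :
    ∃ a ∈ α.spectralSubspace (-1), proj α 1 * b * proj α 0 = of (monomial α 0 a) := by
  let L : α.spectralSubspace (-1) →ₗᵢ[ℂ] CrossedProduct α :=
    { toFun := fun a => constMulL a.1 (proj α 0)
      map_add' := fun a b => constMulL_add _ _ _
      map_smul' := fun c a => constMulL_smul _ _ _
      norm_map' := fun a => by
        change ‖constMulL a.1 (proj α 0)‖ = ‖a.1‖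
        rw [constMulL_proj, norm_of_monomial a.2] }
  have : CompleteSpace (α.spectralSubspace (-1)) :=
    (α.isClosed_spectralSubspace (-1)).completeSpace_coe
  have hcl : IsClosed (Set.range L) := L.isometry.isClosedEmbedding.isClosed_range
  suffices h : proj α 1 * b * proj α 0 ∈ Set.range L by
    obtain ⟨a, ha⟩ := h
    exact ⟨a.1, a.2, ha.symm.trans (constMulL_proj a.1 0)⟩
  refine induction_on b (hcl.preimage (f := fun b => proj α 1 * b * proj α 0) (by fun_prop))
    fun f => ?_
  refine ⟨⟨_, α.fourierCoefficient_mem (-1) (∫ t, f t ∂circleHaar)⟩, ?_⟩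
  change constMulL _ (proj α 0) = proj α 1 * of f * proj α 0
  rw [constMulL_proj, proj, proj, ← of_mul, ← of_mul, mul_assoc]
  congr 1
  ext s
  have h1 : ∀ s, (f * monomial α 0 1) s = ∫ t, f t ∂circleHaar := fun s => by
    rw [mul_apply]
    simp [monomial_apply]
  rw [mul_apply]
  simp only [h1, monomial_apply, zpow_zero, Circle.coe_one, one_smul, smul_mul_assoc, one_mul]
  rfl

end CrossedProduct

/-! ### Approximately unitary elements -/

/-- An element `u` for which `u⋆ u` and `u u⋆` are close to `1` is close to the unitary
`u (u⋆ u)^(-1/2)` of its polar decomposition. -/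
theorem exists_unitary_near {A : Type*} [CStarAlgebra A] {δ : ℝ} (hδ : δ ≤ 1 / 2) {u : A}
    (h1 : ‖star u * u - 1‖ ≤ δ) (h2 : ‖u * star u - 1‖ ≤ δ) :
    ∃ w ∈ unitary A, ‖w - u‖ ≤ 2 * δ := by
  have hδ0 : 0 ≤ δ := (norm_nonneg _).trans h1
  rcases subsingleton_or_nontrivial A with _ | _
  · exact ⟨1, one_mem _, by simp [Subsingleton.elim (1 : A) u, hδ0]⟩
  set h := star u * u with hh
  have hsa : IsSelfAdjoint h := IsSelfAdjoint.star_mul_self u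
  have hspec : ∀ x ∈ spectrum ℝ h, |x - 1| ≤ δ := fun x hx => by
    have : x - 1 ∈ spectrum ℝ (h - 1) := by
      have := spectrum.sub_singleton_eq h (1 : ℝ)
      rw [map_one] at this
      exact this ▸ Set.sub_mem_sub hx rfl
    exact (spectrum.norm_le_norm_of_mem this).trans h1
  have hpos : ∀ x ∈ spectrum ℝ h, 1 / 2 ≤ x := fun x hx => by
    have := abs_le.1 (hspec x hx)
    linarith
  have hcont : ContinuousOn (fun x : ℝ => (√x)⁻¹) (spectrum ℝ h) :=
    Real.continuous_sqrt.continuousOn.inv₀ fun x hx =>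
      (Real.sqrt_pos.2 (by linarith [hpos x hx])).ne'
  set g := cfc (fun x : ℝ => (√x)⁻¹) h with hg
  have hgsa : IsSelfAdjoint g := cfc_predicate _ _
  have hghg : g * h * g = 1 := by
    conv_lhs => rw [hg]
    nth_rw 2 [← cfc_id ℝ h]
    rw [← cfc_mul _ _ _ hcont, ← cfc_mul _ _ _ _ hcont, ← cfc_one ℝ h]
    · refine cfc_congr fun x hx => ?_
      have hx := hpos x hx
      have : 0 < √x := Real.sqrt_pos.2 (by linarith)
      field_simp
      simp [Real.sq_sqrt (by linarith : (0:ℝ) ≤ x)]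
    · fun_prop
  have hw : star (u * g) * (u * g) = 1 := by
    rw [star_mul, hgsa.star_eq, mul_assoc, ← mul_assoc (star u), ← hh, ← mul_assoc, hghg]
  have hnear : ∀ a : A, ‖a - 1‖ ≤ δ → IsUnit a := fun a ha => by
    have := (Units.oneSub (1 - a) (by rw [norm_sub_rev]; linarith)).isUnit
    rwa [Units.val_oneSub, sub_sub_cancel] at this
  have hunit : IsUnit (u * g) := by
    obtain ⟨b, hb⟩ := (hnear _ h1).exists_left_inv
    obtain ⟨c, hc⟩ := (hnear _ h2).exists_right_inv
    refine IsUnit.mul (isUnit_iff_exists_and_exists.2 ⟨⟨star u * c, ?_⟩, ⟨b * star u, ?_⟩⟩)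
      (isUnit_iff_exists_and_exists.2 ⟨⟨h * g, ?_⟩, ⟨g * h, hghg⟩⟩)
    · rw [← mul_assoc, hc]
    · rw [mul_assoc, hb]
    · rw [← mul_assoc, hghg]
  refine ⟨u * g, ⟨hw, ?_⟩, ?_⟩
  · exact hunit.mul_right_cancel (by rw [mul_assoc, hw, mul_one, one_mul])
  have hu : ‖u‖ ≤ 2 := by
    have : ‖u‖ * ‖u‖ ≤ 3 / 2 := by
      rw [← CStarRing.norm_star_mul_self, ← hh]
      have := norm_add_le (h - 1) 1
      rw [sub_add_cancel, CStarRing.norm_one] at this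
      linarith
    nlinarith [norm_nonneg u]
  have hg1 : ‖g - 1‖ ≤ δ := by
    rw [hg, ← cfc_one ℝ h, ← cfc_sub _ _ _ hcont]
    refine norm_cfc_le hδ0 fun x hx => (le_trans ?_ (hspec x hx))
    have hx := hpos x hx
    have hsq : √x * √x = x := Real.mul_self_sqrt (by linarith)
    have hy : 1 / 2 ≤ √x := Real.le_sqrt_of_sq_le (by linarith)
    have h3 : (√x)⁻¹ - 1 = -((√x - 1) * (√x)⁻¹) := by field_simp; ring
    have h4 : x - 1 = (√x - 1) * (√x + 1) := by linarith
    change ‖(√x)⁻¹ - 1‖ ≤ |x - 1|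
    rw [h3, h4, norm_neg, norm_mul, abs_mul, Real.norm_eq_abs, Real.norm_eq_abs]
    refine mul_le_mul_of_nonneg_left ?_ (abs_nonneg _)
    rw [abs_of_pos (by positivity), abs_of_pos (by positivity), inv_le_iff_one_le_mul₀
      (by positivity)]
    nlinarith
  calc ‖u * g - u‖ = ‖u * (g - 1)‖ := by rw [mul_sub, mul_one]
    _ ≤ ‖u‖ * ‖g - 1‖ := norm_mul_le _ _
    _ ≤ 2 * δ := by gcongr

/-! ### From approximate representability to the Rokhlin property -/

section SequenceAlgebra

variable {D E : Type*} [CStarAlgebra D] [CStarAlgebra E]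

namespace SequenceAlgebra

theorem mk_eq_mk_iff (x y : ℕ →ᵇ D) :
    Ideal.Quotient.mk (c0Ideal D) x = Ideal.Quotient.mk (c0Ideal D) y
      ↔ Tendsto (fun n => ‖x n - y n‖) atTop (𝓝 0) :=
  Ideal.Quotient.mk_eq_mk_iff_sub_mem _ _

theorem map_mk (φ : D →⋆ₐ[ℂ] E) (x : ℕ →ᵇ D) :
    map φ (Ideal.Quotient.mk _ x) = Ideal.Quotient.mk _ (seqMap φ x) := rfl

theorem map_star_apply (φ : D →⋆ₐ[ℂ] E) (q : SequenceAlgebra D) :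
    map φ (star q) = star (map φ q) := by
  obtain ⟨x, rfl⟩ := Ideal.Quotient.mk_surjective q
  rw [star_mk, map_mk, map_mk, star_mk]
  exact congrArg _ (BoundedContinuousFunction.ext fun n => StarHomClass.map_star φ (x n))

end SequenceAlgebra

end SequenceAlgebra

section Intertwiner

variable {Q : Type*} [Ring Q] [StarRing Q] {U V : Q} {p : ℤ → Q}

/-- If a unitary `V` shifts the projections `p k` and `U` has the same corners as `V`, then `U` and
`V` agree on each `p k`, so that `U` is unitary up to the `p k`, and `U` commutes with those
elements that `V` intertwines appropriately. -/
theorem shift_relations (hV1 : star V * V = 1) (hV2 : V * star V = 1)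
    (hpp : ∀ k, p k * p k = p k) (hps : ∀ k, star (p k) = p k)
    (hshift : ∀ k, p (k + 1) * V = V * p k) (hpU : ∀ k, p (k + 1) * U = U * p k)
    (hcorner : ∀ k, p (k + 1) * V * p k = U * p k) :
    star U * U * p 0 = p 0 ∧ U * star U * p (0 + 1) = p (0 + 1) ∧
      ∀ (k : ℤ) (a : Q), p (-k) * a = a * p 0 → a * p (0 + 1) * V = V * (a * p 0) →
        U * a * p 0 = a * U * p 0 := by
  have hVp : ∀ k, V * p k = U * p k := fun k => by
    rw [← hcorner, hshift, mul_assoc, hpp]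
  have hpV : ∀ k, p (k + 1) * V = U * p k := fun k => by rw [hshift, hVp]
  have hUp : ∀ k, p k * star U = star U * p (k + 1) := fun k => by
    have := congrArg star (hpU k)
    rw [star_mul, star_mul, hps, hps] at this
    exact this.symm
  refine ⟨?_, ?_, fun k a hpa ha => ?_⟩
  · calc star U * U * p 0 = star U * p (0 + 1) * U * p 0 := by
          rw [mul_assoc (star U) (p (0 + 1)), hpU, mul_assoc, mul_assoc, mul_assoc, hpp]
      _ = star (U * p 0) * (U * p 0) := by
          rw [← hUp, star_mul, hps]; simp only [mul_assoc]
      _ = star (V * p 0) * (V * p 0) := by rw [hVp]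
      _ = p 0 * (star V * V) * p 0 := by rw [star_mul, hps]; simp only [mul_assoc]
      _ = p 0 := by rw [hV1, mul_one, hpp]
  · calc U * star U * p (0 + 1) = U * p 0 * star U := by rw [mul_assoc, ← hUp, mul_assoc]
      _ = (U * p 0) * star (U * p 0) := by
          rw [star_mul, hps, mul_assoc, mul_assoc, ← mul_assoc (p 0), hpp]
      _ = p (0 + 1) * V * star (p (0 + 1) * V) := by rw [hpV]
      _ = p (0 + 1) * (V * star V) * p (0 + 1) := by
          rw [star_mul, hps]; simp only [mul_assoc]
      _ = p (0 + 1) := by rw [hV2, mul_one, hpp]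
  · calc U * a * p 0 = U * p (-k) * a := by rw [mul_assoc, ← hpa, mul_assoc]
      _ = V * p (-k) * a := by rw [hVp]
      _ = V * (a * p 0) := by rw [mul_assoc, hpa]
      _ = a * p (0 + 1) * V := ha.symm
      _ = a * U * p 0 := by rw [mul_assoc, hpV, mul_assoc]

end Intertwiner

namespace CrossedProduct

open ConvolutionAlgebra SequenceAlgebra
open scoped MultiplierAlgebra

variable {A : Type*} [CStarAlgebra A] {α : CircleAction A}

variable (α) in
/-- The projections `proj m` as multipliers. -/
def projMul (m : ℤ) : 𝓜(ℂ, CrossedProduct α) := coeMultiplier (proj α m)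

theorem embed_mul_projMul (a : A) (m : ℤ) :
    embed α a * projMul α m = coeMultiplier (of (monomial α m a)) := by
  rw [projMul, mul_coeMultiplier, embed_fst, constMulL_proj]

theorem projMul_mul_embed {k : ℤ} {a : A} (ha : a ∈ α.spectralSubspace k) (m : ℤ) :
    projMul α m * embed α a = embed α a * projMul α (m + k) := by
  rw [embed_mul_projMul, projMul, coeMultiplier_mul, embed_snd, mulConstL_proj ha]

theorem norm_embed_mul_projMul {k : ℤ} {a : A} (ha : a ∈ α.spectralSubspace k) (m : ℤ) :
    ‖embed α a * projMul α m‖ = ‖a‖ := by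
  rw [embed_mul_projMul, norm_coeMultiplier, norm_of_monomial ha]

theorem projMul_mul_projMul (m : ℤ) : projMul α m * projMul α m = projMul α m := by
  rw [projMul, ← map_mul, proj_mul_proj]

theorem star_projMul (m : ℤ) : star (projMul α m) = projMul α m := by
  rw [projMul, ← map_star, star_proj]

theorem norm_projMul_le (m : ℤ) : ‖projMul α m‖ ≤ 1 := by
  have h := norm_embed_mul_projMul (α := α) CircleAction.one_mem_spectralSubspace m
  rw [map_one, one_mul] at h
  exact h.trans_le (norm_le_one_of_mem_unitary (one_mem _))

theorem multiplierMap_projMul (n m : ℤ) :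
    multiplierMap (dualAut n) (projMul α m) = projMul α (n + m) := by
  rw [projMul, multiplierMap_coeMultiplier]
  exact congrArg coeMultiplier (dualMap_monomial n m 1)

/-- A multiplier fixed by the dual automorphism is fixed by the whole dual action. -/
theorem multiplierMap_dualAut_of_mem {x : 𝓜(ℂ, CrossedProduct α)}
    (hx : x ∈ fixedMultipliers (dualAut (α := α) 1)) (k : ℤ) :
    multiplierMap (dualAut k) x = x := by
  have hcomp : ∀ (m n : ℤ) (y : 𝓜(ℂ, CrossedProduct α)),
      multiplierMap (dualAut m) (multiplierMap (dualAut n) y) = multiplierMap (dualAut (m + n)) y :=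
    fun m n y => by
      have h1 : ∀ b : CrossedProduct α, dualMap (-n) (dualMap (-m) b) = dualMap (-(m + n)) b :=
        fun b => by rw [dualMap_dualMap]; congr 1; ring
      refine multiplier_ext (fun b => ?_) (fun b => ?_)
      · change dualMap m (dualMap n (y.fst (dualMap (-n) (dualMap (-m) b))))
          = dualMap (m + n) (y.fst (dualMap (-(m + n)) b))
        rw [dualMap_dualMap, h1]
      · change dualMap m (dualMap n (y.snd (dualMap (-n) (dualMap (-m) b))))
          = dualMap (m + n) (y.snd (dualMap (-(m + n)) b))
        rw [dualMap_dualMap, h1]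
  have hzero : multiplierMap (dualAut 0) x = x := by
    have hz : ∀ b : CrossedProduct α, dualMap (-0) b = b := fun b => by
      rw [neg_zero, dualMap_zero_left]
    refine multiplier_ext (fun b => ?_) (fun b => ?_)
    · change dualMap 0 (x.fst (dualMap (-0) b)) = x.fst b
      rw [dualMap_zero_left, hz]
    · change dualMap 0 (x.snd (dualMap (-0) b)) = x.snd b
      rw [dualMap_zero_left, hz]
  have h1 : multiplierMap (dualAut 1) x = x := hx
  induction k with
  | zero => exact hzero
  | succ k ih => rw [← hcomp, h1, ih]
  | pred k ih =>
    rw [sub_eq_add_neg]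
    conv_lhs => rw [← h1, hcomp]
    rw [neg_add_cancel_right, ih]

/-- A multiplier fixed by the dual action has a homogeneous component of degree `-1`: an element
`a` of `A` with `p_{k+1} x p_k = a p_k` for all `k`. -/
theorem exists_homogeneous_component {x : 𝓜(ℂ, CrossedProduct α)}
    (hx : x ∈ fixedMultipliers (dualAut (α := α) 1)) :
    ∃ a ∈ α.spectralSubspace (-1),
      ∀ k, projMul α (k + 1) * x * projMul α k = embed α a * projMul α k := by
  obtain ⟨a, ha, h⟩ := exists_proj_one_mul_mul_proj_zero (x.fst (proj α 0))
  have h0 : projMul α 1 * x * projMul α 0 = embed α a * projMul α 0 := by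
    rw [embed_mul_projMul, ← h, map_mul, map_mul, ← mul_coeMultiplier]
    change _ = projMul α 1 * (x * projMul α 0) * projMul α 0
    rw [mul_assoc, mul_assoc, mul_assoc, projMul_mul_projMul]
  refine ⟨a, ha, fun k => ?_⟩
  have := congrArg (multiplierMap (dualAut k)) h0
  rwa [map_mul, map_mul, map_mul, multiplierMap_projMul, multiplierMap_projMul,
    multiplierMap_dualAut_of_mem hx, multiplierMap_dualAut_embed, add_zero] at this

theorem norm_star_embed_mul_embed_sub {k : ℤ} {a : A} (ha : a ∈ α.spectralSubspace k) (m : ℤ) :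
    ‖star (embed α a) * embed α a * projMul α m - projMul α m‖ = ‖star a * a - 1‖ := by
  have h := CircleAction.mul_mem_spectralSubspace (CircleAction.star_mem_spectralSubspace ha) ha
  rw [neg_add_cancel] at h
  rw [← norm_embed_mul_projMul (Submodule.sub_mem _ h CircleAction.one_mem_spectralSubspace) m,
    map_sub, map_mul, map_one, sub_mul, one_mul, map_star]

theorem norm_embed_mul_star_embed_sub {k : ℤ} {a : A} (ha : a ∈ α.spectralSubspace k) (m : ℤ) :
    ‖embed α a * star (embed α a) * projMul α m - projMul α m‖ = ‖a * star a - 1‖ := by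
  have h := norm_star_embed_mul_embed_sub (CircleAction.star_mem_spectralSubspace ha) m
  rwa [map_star, star_star, star_star] at h

theorem norm_embed_commutator {j k : ℤ} {a b : A} (ha : a ∈ α.spectralSubspace j)
    (hb : b ∈ α.spectralSubspace k) (m : ℤ) :
    ‖embed α a * embed α b * projMul α m - embed α b * embed α a * projMul α m‖
      = ‖a * b - b * a‖ := by
  have h := CircleAction.mul_mem_spectralSubspace hb ha
  rw [add_comm] at h
  rw [← norm_embed_mul_projMul
    (Submodule.sub_mem _ (CircleAction.mul_mem_spectralSubspace ha hb) h) m,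
    map_sub, map_mul, map_mul, sub_mul]

/-- Approximate representability yields a bounded, asymptotically unitary and asymptotically
central sequence of homogeneous elements of degree `-1`. -/
theorem exists_seq_of_isApproximatelyRepresentable
    (h : IsApproximatelyRepresentable (dualAut (α := α) 1)) :
    ∃ (u : ℕ → A) (C : ℝ), (∀ n, u n ∈ α.spectralSubspace (-1)) ∧ (∀ n, ‖u n‖ ≤ C) ∧
      Tendsto (fun n => ‖star (u n) * u n - 1‖) atTop (𝓝 0) ∧
      Tendsto (fun n => ‖u n * star (u n) - 1‖) atTop (𝓝 0) ∧
      ∀ k, ∀ a ∈ α.spectralSubspace k,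
        Tendsto (fun n => ‖u n * a - a * u n‖) atTop (𝓝 0) := by
  obtain ⟨v, hv, hrep⟩ := h
  obtain ⟨x, rfl⟩ := Ideal.Quotient.mk_surjective v
  choose u hu hux using fun n => exists_homogeneous_component (x n).2
  have hbound : ∀ n, ‖u n‖ ≤ ‖x‖ := fun n => by
    rw [← norm_embed_mul_projMul (hu n) 0, ← hux]
    have h1 := norm_projMul_le (α := α) (0 + 1)
    have h2 := norm_projMul_le (α := α) 0
    have h3 : ‖(x n : 𝓜(ℂ, CrossedProduct α))‖ ≤ ‖x‖ := x.norm_coe_le_norm n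
    calc _ ≤ ‖projMul α (0 + 1) * (x n : 𝓜(ℂ, CrossedProduct α))‖ * ‖projMul α 0‖ :=
          norm_mul_le _ _
      _ ≤ ‖projMul α (0 + 1) * (x n : 𝓜(ℂ, CrossedProduct α))‖ :=
          mul_le_of_le_one_right (norm_nonneg _) h2
      _ ≤ ‖projMul α (0 + 1)‖ * ‖(x n : 𝓜(ℂ, CrossedProduct α))‖ := norm_mul_le _ _
      _ ≤ ‖(x n : 𝓜(ℂ, CrossedProduct α))‖ := mul_le_of_le_one_left (norm_nonneg _) h1
      _ ≤ ‖x‖ := h3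
  let y : ℕ →ᵇ 𝓜(ℂ, CrossedProduct α) :=
    BoundedContinuousFunction.ofNormedAddCommGroup (fun n => embed α (u n))
      continuous_of_discreteTopology ‖x‖
      fun n => (NonUnitalStarAlgHom.norm_apply_le (embed α) (u n)).trans (hbound n)
  -- All asymptotic identities become identities in `M(B)_∞`.
  set V := SequenceAlgebra.map (fixedMultipliers (dualAut (α := α) 1)).subtype
    (Ideal.Quotient.mk _ x) with hV
  set U : SequenceAlgebra 𝓜(ℂ, CrossedProduct α) := Ideal.Quotient.mk _ y
  set p : ℤ → SequenceAlgebra 𝓜(ℂ, CrossedProduct α) := fun k => const (projMul α k)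
  set e : A → SequenceAlgebra 𝓜(ℂ, CrossedProduct α) := fun a => const (embed α a)
  have hV1 : star V * V = 1 := by
    rw [hV, ← SequenceAlgebra.map_star_apply, ← map_mul, hv.1, map_one]
  have hV2 : V * star V = 1 := by
    rw [hV, ← SequenceAlgebra.map_star_apply, ← map_mul, hv.2, map_one]
  have hcorner : ∀ k, p (k + 1) * V * p k = U * p k := fun k =>
    congrArg (Ideal.Quotient.mk _) (BoundedContinuousFunction.ext fun n => hux n k)
  have hpU : ∀ k, p (k + 1) * U = U * p k := fun k =>
    congrArg (Ideal.Quotient.mk _) (BoundedContinuousFunction.ext fun n => by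
      have := projMul_mul_embed (hu n) (k + 1)
      rwa [add_neg_cancel_right] at this)
  have hpp : ∀ k, p k * p k = p k := fun k => congrArg const (projMul_mul_projMul k)
  have hps : ∀ k, star (p k) = p k := fun k => congrArg const (star_projMul k)
  have hrep' : ∀ (k : ℤ) (a : A), e a * p (k + 1) * V = V * (e a * p k) := fun k a => by
    have h1 := hrep (of (monomial α k a))
    have h2 : dualAut 1 (of (monomial α k a)) = of (monomial α (k + 1) a) :=
      (dualMap_monomial 1 k a).trans (by rw [add_comm])
    have h3 : ∀ m, const (DoubleCentralizer.coe ℂ (of (monomial α m a))) = e a * p m := fun m =>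
      congrArg const (embed_mul_projMul a m).symm
    rw [h2, h3, h3] at h1
    rw [h1, mul_assoc, hV1, mul_one]
  have he1 : e 1 = 1 := congrArg const (map_one (embed α))
  have hshift : ∀ k, p (k + 1) * V = V * p k := fun k => by
    have := hrep' k 1
    rwa [he1, one_mul, one_mul] at this
  have hpe : ∀ k, ∀ a ∈ α.spectralSubspace k, p (-k) * e a = e a * p 0 := fun k a ha => by
    have := projMul_mul_embed ha (-k)
    rw [neg_add_cancel] at this
    exact congrArg const this
  obtain ⟨h1, h2, h3⟩ := shift_relations hV1 hV2 hpp hps hshift hpU hcorner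
  refine ⟨u, ‖x‖, hu, hbound, ?_, ?_, fun k a ha => ?_⟩
  · refine ((mk_eq_mk_iff (star y * y * BoundedContinuousFunction.const ℕ (projMul α 0)) _).1
      h1).congr fun n => ?_
    exact norm_star_embed_mul_embed_sub (hu n) 0
  · refine ((mk_eq_mk_iff (y * star y * BoundedContinuousFunction.const ℕ (projMul α (0 + 1)))
      _).1 h2).congr fun n => ?_
    exact norm_embed_mul_star_embed_sub (hu n) (0 + 1)
  · refine ((mk_eq_mk_iff (y * BoundedContinuousFunction.const ℕ (embed α a)
      * BoundedContinuousFunction.const ℕ (projMul α 0))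
      (BoundedContinuousFunction.const ℕ (embed α a) * y
        * BoundedContinuousFunction.const ℕ (projMul α 0))).1
      (h3 k (e a) (hpe k a ha) (hrep' 0 a))).congr fun n => ?_
    exact norm_embed_commutator (hu n) ha 0

theorem hasRokhlinProperty_of_isApproximatelyRepresentable
    (h : IsApproximatelyRepresentable (dualAut (α := α) 1)) : α.HasRokhlinProperty := by
  obtain ⟨u, C, hu, hC, h1, h2, h3⟩ := exists_seq_of_isApproximatelyRepresentable h
  have hcentral : ∀ a, Tendsto (fun n => ‖u n * a - a * u n‖) atTop (𝓝 0) := by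
    have hcl := isClosed_setOf_tendsto_norm_zero (fun n a => u n * a - a * u n) (2 * C)
      fun n x y => by
        have : u n * x - x * u n - (u n * y - y * u n) = u n * (x - y) - (x - y) * u n := by
          noncomm_ring
        rw [this]
        refine (norm_sub_le _ _).trans ?_
        have h4 := norm_mul_le (u n) (x - y)
        have h5 := norm_mul_le (x - y) (u n)
        have h6 := mul_le_mul_of_nonneg_right (hC n) (norm_nonneg (x - y))
        linarith
    have hsub : ((⨆ k, α.spectralSubspace k : Submodule ℂ A) : Set A)
        ⊆ {a | Tendsto (fun n => ‖u n * a - a * u n‖) atTop (𝓝 0)} := fun a ha => by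
      refine Submodule.iSup_induction _ (motive := fun a =>
        Tendsto (fun n => ‖u n * a - a * u n‖) atTop (𝓝 0)) ha h3 (by simp) fun a b ha hb => ?_
      refine squeeze_zero (fun n => norm_nonneg _) (fun n => ?_) (by simpa using ha.add hb)
      refine (congrArg norm ?_).trans_le (norm_add_le _ _)
      noncomm_ring
    intro a
    have ha : a ∈ (⨆ k, α.spectralSubspace k).topologicalClosure :=
      α.iSup_spectralSubspace_topologicalClosure ▸ trivial
    exact hcl.closure_subset_iff.2 hsub ha
  intro ε hε F
  set K := ∑ a ∈ F, ‖a‖ with hK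
  have hK0 : 0 ≤ K := Finset.sum_nonneg fun a _ => norm_nonneg a
  -- With `‖w - u‖ ≤ 2δ`, the constant `δ` has to make both `4δ` and `4δ‖a‖` less than `ε / 2`.
  set δ := min (1 / 2) (ε / (16 * (K + 1))) with hδ
  have hδ0 : 0 < δ := lt_min (by norm_num) (by positivity)
  have hδε : 16 * (δ * (K + 1)) ≤ ε := by
    have := min_le_right (1 / 2) (ε / (16 * (K + 1)))
    rw [← hδ, le_div_iff₀ (by positivity)] at this
    linarith
  obtain ⟨n, hn1, hn2, hn3⟩ := ((h1.eventually_le_const hδ0).and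
    ((h2.eventually_le_const hδ0).and ((Finset.eventually_all F).2 fun a _ =>
      (hcentral a).eventually_lt_const (half_pos hε)))).exists
  obtain ⟨w, hw, hwu⟩ := exists_unitary_near (min_le_left _ _) hn1 hn2
  refine ⟨star w, Unitary.star_mem hw, fun ζ => ?_, fun a ha => ?_⟩
  · have hs : α ζ (star (u n)) = (ζ : ℂ) • star (u n) := by
      simpa using CircleAction.star_mem_spectralSubspace (hu n) ζ
    have : α ζ (star w) - (ζ : ℂ) • star w
        = α ζ (star (w - u n)) - (ζ : ℂ) • star (w - u n) := by
      rw [star_sub, map_sub, hs, smul_sub]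
      abel
    rw [this]
    refine (norm_sub_le _ _).trans_lt ?_
    rw [StarAlgEquiv.norm_map, norm_smul, Circle.norm_coe, one_mul, norm_star]
    nlinarith
  · have hwa : ‖w * a - a * w‖ < ε := by
      have : w * a - a * w = (w - u n) * a - a * (w - u n) + (u n * a - a * u n) := by
        noncomm_ring
      rw [this]
      have h4 := norm_mul_le (w - u n) a
      have h5 := norm_mul_le a (w - u n)
      have h6 : ‖w - u n‖ * ‖a‖ ≤ 2 * δ * K := mul_le_mul hwu
        (Finset.single_le_sum (f := fun a => ‖a‖) (fun a _ => norm_nonneg a) ha)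
        (norm_nonneg _) (by positivity)
      have h7 := hn3 a ha
      have h8 := (norm_add_le ((w - u n) * a - a * (w - u n)) (u n * a - a * u n)).trans
        (add_le_add_left (norm_sub_le _ _) _)
      nlinarith
    have : star w * a - a * star w = star w * (a * w - w * a) * star w := by
      rw [mul_sub, sub_mul, ← mul_assoc (star w) w, Unitary.star_mul_self_of_mem hw, one_mul,
        mul_assoc, mul_assoc, Unitary.mul_star_self_of_mem hw, mul_one]
    rw [this]
    have hw1 := norm_le_one_of_mem_unitary (Unitary.star_mem hw)
    refine lt_of_le_of_lt ?_ hwa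
    rw [norm_sub_rev (w * a)]
    calc _ ≤ ‖star w * (a * w - w * a)‖ * ‖star w‖ := norm_mul_le _ _
      _ ≤ ‖star w * (a * w - w * a)‖ := mul_le_of_le_one_right (norm_nonneg _) hw1
      _ ≤ ‖star w‖ * ‖a * w - w * a‖ := norm_mul_le _ _
      _ ≤ ‖a * w - w * a‖ := mul_le_of_le_one_left (norm_nonneg _) hw1

end CrossedProduct

end

theorem mainTheorem10 {A : Type*} [CStarAlgebra A] [TopologicalSpace.SeparableSpace A]
    (α : CircleAction A) :
    α.HasRokhlinProperty ↔
      IsApproximatelyRepresentable (α.dualAction (Multiplicative.ofAdd (1 : ℤ))) :=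
  ⟨CrossedProduct.isApproximatelyRepresentable_of_hasRokhlinProperty,
    CrossedProduct.hasRokhlinProperty_of_isApproximatelyRepresentable⟩
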